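/- Let $n\ge 1$, $m\ge n$ and $t>n$ be integers. A \emph{$t$-doped POVM} on $n$ data qubits with $m$ ancillas is a POVM $\mu=(\mu_b)_{b\in\{0,1\}^{n+m}}$ of the form $$\mu_b=\operatorname{Tr}_R\big[U^\dagger\,|\Phi_b\rangle\langle\Phi_b|\,U\,(I\otimes|\psi\rangle\langle\psi|)\big],$$ where $\operatorname{Tr}_R$ is the partial trace over the ancillas, $\psi$ is an $m$-qubit stabilizer state, $(\Phi_b)_b$ is an $(n+m)$-qubit stabilizer basis (an orthonormal basis of common eigenvectors of a maximal Abelian group of Pauli strings), and $U$ is the unitary of a circuit on the $n+m$ qubits made of Clifford unitaries and exactly $t$ gates $T=\operatorname{diag}(1,e^{i\pi/4})$. Put $s_\mu=\dim\operatorname{span}\{\mu_b\}_b$, and let $\ell=t-n$, $a=\lfloor t/\ell\rfloor$, $r=t-a\ell$. (i) The maximum $A$ of $s_\mu$ over all $t$-doped POVMs $\mu$ on $n$ data qubits with $m$ ancillas exists and satisfies $$A\;\ge\;2^{-\ell}\,(3^{a+1}-1)^r\,(3^a-1)^{\ell-r}.$$ (ii) The bound is witnessed by disjoint-support generators of the form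 $X\cdots XZ$: there is a $t$-doped POVM $\mu$ on $n$ data qubits with $m$ ancillas such that $s_\mu=2^{-\ell}(3^{a+1}-1)^r(3^a-1)^{\ell-r}$, together with a partition of $t$ qubits into $\ell$ sets, $r$ of size $a+1$ and $\ell-r$ of size $a$, and a maximal Abelian group $\mathcal S$ of $(n+t)$-qubit Pauli strings (modulo phases) with common eigenbasis $(\Phi'_b)_b$, with the following properties. No nontrivial element of $\mathcal S$ acts trivially on the last $t$ qubits. The elements of $\mathcal S$ that act trivially on the first $n$ qubits form the group generated by the $\ell$ strings that act on the $t$ qubits as $X\cdots XZ$ on one set of the partition ($Z$ on its last qubit, $X$ on its other qubits) and trivially elsewhere. Finally, $\mu$ has the same linear span as the operators $(I\otimes\langle T|^{\otimes t})\,|\Phi'_b\rangle\langle\Phi'_b|\,(I\otimes|T\rangle^{\otimes t})$, where $|T\rangle=(|0\rangle+e^{i\pi/4}|1\rangle)/\sqrt2$. -/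

import Mathlib

/-! ### Qubit registers and Pauli strings

A register of qubits is indexed by a finite type `ι`; its computational basis is `ι → Fin 2`. -/

/-- The Hilbert space of the qubits indexed by `ι`. -/
abbrev QSpace (ι : Type) : Type := EuclideanSpace ℂ (ι → Fin 2)

/-- Operators on the Hilbert space of the qubits indexed by `ι`. -/
abbrev QOp (ι : Type) : Type := Matrix (ι → Fin 2) (ι → Fin 2) ℂ

/-- A Pauli string modulo phases: `(0,0), (1,0), (1,1), (0,1)` stand for the letters `I, X, Y, Z`.
Multiplication of Pauli strings modulo phases is addition here. -/
abbrev PauliString (ι : Type) : Type := ι → ZMod 2 × ZMod 2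

noncomputable section

/-- The one-qubit Pauli matrices `I, X, Y, Z`. -/
def pauliMatrix (p : ZMod 2 × ZMod 2) : Matrix (Fin 2) (Fin 2) ℂ :=
  if p = (0, 0) then 1
  else if p = (1, 0) then !![0, 1; 1, 0]
  else if p = (1, 1) then !![0, -Complex.I; Complex.I, 0]
  else !![1, 0; 0, -1]

/-- The Hermitian operator (tensor product of Pauli matrices) of a Pauli string. -/
def pauliOp {ι : Type} [Fintype ι] (g : PauliString ι) : QOp ι :=
  Matrix.of fun s s' => ∏ k, pauliMatrix (g k) (s k) (s' k)

/-- The rank-one operator `|ψ⟩⟨ψ|`. -/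
def ketbra {ι : Type} (ψ : QSpace ι) : QOp ι :=
  Matrix.of fun s s' => ψ s * star (ψ s')

/-! ### Stabilizer formalism -/

/-- Stabilizer groups modulo phases: maximal Abelian subgroups, i.e. groups of Pauli strings whose
operators commute and which contain every string commuting with all of their elements. -/
def IsStabilizerGroup {ι : Type} [Fintype ι] [DecidableEq ι]
    (S : AddSubgroup (PauliString ι)) : Prop :=
  (∀ g ∈ S, ∀ h ∈ S, Commute (pauliOp g) (pauliOp h)) ∧
    ∀ g : PauliString ι, (∀ h ∈ S, Commute (pauliOp g) (pauliOp h)) → g ∈ S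

/-- `ψ` is a common eigenvector of the strings in `S`; since the operators of the strings square to
the identity, the eigenvalues are `±1`. -/
def IsCommonEigenvector {ι : Type} [Fintype ι] [DecidableEq ι] (S : AddSubgroup (PauliString ι))
    (ψ : QSpace ι) : Prop :=
  ∀ g ∈ S, (pauliOp g).mulVec ψ.ofLp = ψ.ofLp ∨ (pauliOp g).mulVec ψ.ofLp = -ψ.ofLp

/-- Stabilizer states: unit vectors that are fixed, for each `g` of some stabilizer group modulo
phases, by `g` or by `-g`. -/
def IsStabilizerState {ι : Type} [Fintype ι] [DecidableEq ι] (ψ : QSpace ι) : Prop :=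
  ‖ψ‖ = 1 ∧ ∃ S : AddSubgroup (PauliString ι), IsStabilizerGroup S ∧ IsCommonEigenvector S ψ

/-- `Φ` is the stabilizer basis of the stabilizer group `S` modulo phases. -/
def IsStabilizerBasisOf {ι : Type} [Fintype ι] [DecidableEq ι] (S : AddSubgroup (PauliString ι))
    (Φ : OrthonormalBasis (ι → Fin 2) ℂ (QSpace ι)) : Prop :=
  IsStabilizerGroup S ∧ ∀ b, IsCommonEigenvector S (Φ b)

/-- Stabilizer bases. -/
def IsStabilizerBasis {ι : Type} [Fintype ι] [DecidableEq ι]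
    (Φ : OrthonormalBasis (ι → Fin 2) ℂ (QSpace ι)) : Prop :=
  ∃ S : AddSubgroup (PauliString ι), IsStabilizerBasisOf S Φ

/-- Clifford unitaries: unitaries that map the Pauli group (with phases `±1, ±i`) to itself by
conjugation. -/
def IsClifford {ι : Type} [Fintype ι] [DecidableEq ι] (U : QOp ι) : Prop :=
  U ∈ Matrix.unitaryGroup (ι → Fin 2) ℂ ∧
    ∀ g : PauliString ι, ∃ (c : ℂ) (h : PauliString ι), c ^ 4 = 1 ∧
      U * pauliOp g * U.conjTranspose = c • pauliOp h

/-! ### `t`-doped circuits and their effective POVMs -/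

/-- The gate `T = diag(1, e^{iπ/4})` on qubit `k`. -/
def tGate {ι : Type} [Fintype ι] (k : ι) : QOp ι :=
  Matrix.diagonal fun s => if s k = 1 then Complex.exp (Complex.I * (Real.pi / 4)) else 1

/-- Unitaries of circuits that consist of Clifford unitaries and exactly `t` gates `T`. -/
inductive IsDoped {ι : Type} [Fintype ι] [DecidableEq ι] : ℕ → QOp ι → Prop
  | clifford (C : QOp ι) (hC : IsClifford C) : IsDoped 0 C
  | step (t : ℕ) (U C : QOp ι) (k : ι) (hU : IsDoped t U) (hC : IsClifford C) :
      IsDoped (t + 1) (C * tGate k * U)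

/-- The operator `I ⊗ ρ` on the register `ι ⊕ κ`. -/
def idTensor {ι κ : Type} [Fintype ι] (ρ : QOp κ) : QOp (ι ⊕ κ) :=
  Matrix.of fun s s' =>
    if s ∘ Sum.inl = s' ∘ Sum.inl then ρ (s ∘ Sum.inr) (s' ∘ Sum.inr) else 0

/-- The partial trace over the register `κ`. -/
def partialTrace {ι κ : Type} [Fintype κ] [DecidableEq κ] (M : QOp (ι ⊕ κ)) : QOp ι :=
  Matrix.of fun s s' => ∑ e : κ → Fin 2, M (Sum.elim s e) (Sum.elim s' e)

/-- The effective POVM `μ_b = Tr_κ[U† |Φ_b⟩⟨Φ_b| U (I ⊗ |ψ⟩⟨ψ|)]` on the data qubits `ι`, for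
ancillas `κ` in the state `ψ`, evolution `U` and measurement basis `Φ`. -/
def effectivePOVM {ι κ : Type} [Fintype ι] [DecidableEq ι] [Fintype κ] [DecidableEq κ]
    (U : QOp (ι ⊕ κ)) (ψ : QSpace κ)
    (Φ : OrthonormalBasis (ι ⊕ κ → Fin 2) ℂ (QSpace (ι ⊕ κ))) : (ι ⊕ κ → Fin 2) → QOp ι :=
  fun b => partialTrace (U.conjTranspose * ketbra (Φ b) * U * idTensor (ketbra ψ))

/-- The `t`-doped POVMs on `n` data qubits with `m` ancillas. -/
def IsDopedPOVM (n m t : ℕ) (μ : (Fin n ⊕ Fin m → Fin 2) → QOp (Fin n)) : Prop :=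
  ∃ (U : QOp (Fin n ⊕ Fin m)) (ψ : QSpace (Fin m))
    (Φ : OrthonormalBasis (Fin n ⊕ Fin m → Fin 2) ℂ (QSpace (Fin n ⊕ Fin m))),
    IsDoped t U ∧ IsStabilizerState ψ ∧ IsStabilizerBasis Φ ∧ μ = effectivePOVM U ψ Φ

/-- The linear span of the elements of a POVM. -/
def povmSpan {ι β : Type} (μ : β → QOp ι) : Submodule ℂ (QOp ι) :=
  Submodule.span ℂ (Set.range μ)

/-- The number `s_μ`: the dimension of the linear span of the elements of `μ`. -/
def povmDim {ι β : Type} (μ : β → QOp ι) : ℕ :=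
  Module.finrank ℂ (povmSpan μ)

/-! ### Data of the explicit constructions -/

/-- The product `|T⟩^{⊗κ}` of the magic states `|T⟩ = (|0⟩ + e^{iπ/4}|1⟩)/√2`. -/
def magicState (κ : Type) [Fintype κ] : QSpace κ :=
  WithLp.toLp 2 fun s => ∏ k, (if s k = 1 then Complex.exp (Complex.I * (Real.pi / 4)) else 1) /
    (Real.sqrt 2 : ℂ)

/-- The string `X⋯XZ` with support `B`: `Z` on the last qubit of `B`, `X` on the other qubits
of `B`, `I` elsewhere. -/
def xxzString {t : ℕ} (B : Finset (Fin t)) : PauliString (Fin t) :=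
  fun k => if k ∈ B then (if ∀ j ∈ B, j ≤ k then (0, 1) else (1, 0)) else (0, 0)

/-- The lower bound `2^{-ℓ} (3^{a+1} - 1)^r (3^a - 1)^{ℓ - r}`. -/
def dopedBound (ℓ a r : ℕ) : ℝ :=
  ((2 : ℝ) ^ ℓ)⁻¹ * ((3 : ℝ) ^ (a + 1) - 1) ^ r * ((3 : ℝ) ^ a - 1) ^ (ℓ - r)

end

/-! Rank-one projectors of a stabilizer basis span the same space as the Pauli strings of its group
(`span_ketbra_eq_span_pauliOp`). So the span of a doped POVM is the span of the effective operators
of these strings. All circuits used here act on the ancillas only; then the effective operator of a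
string is a multiple of its data part. Hence the dimension is the number of distinct data parts that
occur with a nonzero factor (`HasEffectiveSupport.povmSpan_eq`, `finrank_span_pauliOp`).

A `T` gate conjugated by Cliffords is a rotation about a Pauli string `P`. In the Heisenberg picture
it fixes the strings commuting with `P` and maps an anticommuting `g` to a combination of `g` and
`gP` with nonzero coefficients. As long as `g` and `gP` never both contribute, nothing cancels, and
the set of contributing strings grows in a purely combinatorial way
(`HasEffectiveSupport.pauliRotation_mul`).

The circuit starts from `|+⟩` on all ancillas, spends `n` gates to turn `n` of them into magic
states, and spends `ℓ` gates on rotations about `X⋯X`, one per block, where the `n` ancillas are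
divided into `ℓ` blocks (`exists_isDoped_blockSupport`). A Bell measurement copies each data letter
to its ancilla. A data string then contributes iff each block either has no `Z`, or has no `Y` and
an odd number of `Z`. On `f` qubits there are `3^f + (3^f - 1)/2 = (3^(f+1) - 1)/2` such strings
(`card_fiberSupport`), and the product over the blocks is the bound.

In the magic state form, each block receives one extra qubit that stands for its rotation. This
explains the exponent `f + 1` and the `Z` that ends the generator `X⋯XZ`. The group `codeGroup` on
`n + t` qubits admits exactly the same data strings, hence has the same span. The maximum in (i)
exists because dimensions are bounded, and (ii) bounds it from below. -/

open Matrix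

/-! ### Pauli strings as an operator basis, and the symplectic form. -/

section PauliAlgebra

variable {ι : Type} [Fintype ι]

/-- The tensor product of one-qubit operators. -/
noncomputable def tensorOp (M : ι → Matrix (Fin 2) (Fin 2) ℂ) : QOp ι :=
  Matrix.of fun s s' => ∏ k, M k (s k) (s' k)

theorem pauliOp_eq_tensorOp (g : PauliString ι) :
    pauliOp g = tensorOp fun k => pauliMatrix (g k) := rfl

theorem prod_sum_eq_sum_prod [DecidableEq ι] (f : ι → Fin 2 → ℂ) :
    ∏ k, ∑ b, f k b = ∑ s : ι → Fin 2, ∏ k, f k (s k) := by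
  rw [Finset.prod_univ_sum, Fintype.piFinset_univ]

theorem tensorOp_mul [DecidableEq ι] (M N : ι → Matrix (Fin 2) (Fin 2) ℂ) :
    tensorOp M * tensorOp N = tensorOp fun k => M k * N k := by
  ext s s'
  simp only [tensorOp, Matrix.mul_apply, Matrix.of_apply, prod_sum_eq_sum_prod,
    Finset.prod_mul_distrib]

theorem tensorOp_smul (c : ι → ℂ) (M : ι → Matrix (Fin 2) (Fin 2) ℂ) :
    tensorOp (fun k => c k • M k) = (∏ k, c k) • tensorOp M := by
  ext s s'
  simp [tensorOp, Finset.prod_mul_distrib]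

theorem trace_tensorOp [DecidableEq ι] (M : ι → Matrix (Fin 2) (Fin 2) ℂ) :
    (tensorOp M).trace = ∏ k, (M k).trace := by
  simp only [Matrix.trace, tensorOp, prod_sum_eq_sum_prod, Matrix.diag_apply, Matrix.of_apply]

@[simp] theorem pauliMatrix_I : pauliMatrix (0, 0) = 1 := by simp [pauliMatrix]
@[simp] theorem pauliMatrix_X : pauliMatrix (1, 0) = !![0, 1; 1, 0] := by simp [pauliMatrix]
@[simp] theorem pauliMatrix_Y : pauliMatrix (1, 1) = !![0, -Complex.I; Complex.I, 0] := by
  simp [pauliMatrix]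
@[simp] theorem pauliMatrix_Z : pauliMatrix (0, 1) = !![1, 0; 0, -1] := by simp [pauliMatrix]

theorem pauliLetter_cases (p : ZMod 2 × ZMod 2) :
    p = (0, 0) ∨ p = (1, 0) ∨ p = (1, 1) ∨ p = (0, 1) := by
  revert p; decide

theorem zmod_two_cases (x : ZMod 2) : x = 0 ∨ x = 1 := by
  revert x; decide

/-- The character `x ↦ (-1) ^ x` of `ZMod 2`. -/
noncomputable def pauliSign (x : ZMod 2) : ℂ := if x = 0 then 1 else -1

@[simp] theorem pauliSign_zero : pauliSign 0 = 1 := by simp [pauliSign]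

@[simp] theorem pauliSign_one : pauliSign 1 = -1 := by simp [pauliSign]

theorem pauliSign_add (x y : ZMod 2) : pauliSign (x + y) = pauliSign x * pauliSign y := by
  rcases zmod_two_cases x with rfl | rfl <;> rcases zmod_two_cases y with rfl | rfl <;>
    simp [show (1 : ZMod 2) + 1 = 0 from rfl]

theorem pauliSign_sum {κ : Type} (s : Finset κ) (f : κ → ZMod 2) :
    pauliSign (∑ k ∈ s, f k) = ∏ k ∈ s, pauliSign (f k) := by
  classical
  induction s using Finset.induction_on with
  | empty => simp
  | insert a s ha ih => rw [Finset.sum_insert ha, Finset.prod_insert ha, pauliSign_add, ih]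

/-- The symplectic form on Pauli letters. -/
def letterForm (p q : ZMod 2 × ZMod 2) : ZMod 2 := p.1 * q.2 + p.2 * q.1

/-- The symplectic form on Pauli strings: `0` for commuting and `1` for anticommuting strings. -/
def sympForm (g h : PauliString ι) : ZMod 2 := ∑ k, letterForm (g k) (h k)

theorem letterForm_comm (p q : ZMod 2 × ZMod 2) : letterForm p q = letterForm q p := by
  simp only [letterForm]; ring

theorem sympForm_comm (g h : PauliString ι) : sympForm g h = sympForm h g :=
  Finset.sum_congr rfl fun _ _ => letterForm_comm _ _

theorem letterForm_add (p q q' : ZMod 2 × ZMod 2) :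
    letterForm p (q + q') = letterForm p q + letterForm p q' := by
  simp only [letterForm, Prod.fst_add, Prod.snd_add]; ring

theorem sympForm_add (g h h' : PauliString ι) :
    sympForm g (h + h') = sympForm g h + sympForm g h' := by
  simp only [sympForm, Pi.add_apply, letterForm_add, Finset.sum_add_distrib]

theorem sympForm_single [DecidableEq ι] (g : PauliString ι) (k : ι) (p : ZMod 2 × ZMod 2) :
    sympForm g (Pi.single k p) = letterForm (g k) p := by
  rw [sympForm, Finset.sum_eq_single k]
  · simp
  · intro b _ hb; simp [hb, letterForm]
  · simp

theorem pauliMatrix_mul (p q : ZMod 2 × ZMod 2) :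
    ∃ c : ℂ, c ^ 4 = 1 ∧ pauliMatrix p * pauliMatrix q = c • pauliMatrix (p + q) := by
  have h2 : (1 : ZMod 2) + 1 = 0 := rfl
  have key : ∃ c : ℂ, (c = 1 ∨ c = Complex.I ∨ c = -Complex.I) ∧
      pauliMatrix p * pauliMatrix q = c • pauliMatrix (p + q) := by
    rcases pauliLetter_cases p with rfl | rfl | rfl | rfl <;>
      rcases pauliLetter_cases q with rfl | rfl | rfl | rfl <;>
      simp [h2, Matrix.one_fin_two]
  obtain ⟨c, hc, h⟩ := key
  refine ⟨c, ?_, h⟩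
  rcases hc with rfl | rfl | rfl <;> simp [Even.neg_pow (show Even 4 by decide)]

theorem pauliMatrix_mul_comm (p q : ZMod 2 × ZMod 2) :
    pauliMatrix p * pauliMatrix q =
      pauliSign (letterForm p q) • (pauliMatrix q * pauliMatrix p) := by
  have h2 : (1 : ZMod 2) + 1 = 0 := rfl
  rcases pauliLetter_cases p with rfl | rfl | rfl | rfl <;>
      rcases pauliLetter_cases q with rfl | rfl | rfl | rfl <;>
      simp [h2, Matrix.one_fin_two, letterForm]

theorem trace_pauliMatrix (p : ZMod 2 × ZMod 2) :
    (pauliMatrix p).trace = if p = 0 then 2 else 0 := by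
  rcases pauliLetter_cases p with rfl | rfl | rfl | rfl <;>
    simp [Matrix.trace_fin_two, Prod.ext_iff]

theorem conjTranspose_pauliMatrix (p : ZMod 2 × ZMod 2) :
    (pauliMatrix p)ᴴ = pauliMatrix p := by
  rcases pauliLetter_cases p with rfl | rfl | rfl | rfl
  · simp
  all_goals ext i j; fin_cases i <;> fin_cases j <;> simp

theorem pauliMatrix_mul_self (p : ZMod 2 × ZMod 2) : pauliMatrix p * pauliMatrix p = 1 := by
  rcases pauliLetter_cases p with rfl | rfl | rfl | rfl <;>
    simp [Matrix.one_fin_two]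

theorem pauliOp_zero : pauliOp (0 : PauliString ι) = 1 := by
  ext s s'
  simp only [pauliOp, Matrix.of_apply, Pi.zero_apply]
  rw [show (0 : ZMod 2 × ZMod 2) = (0, 0) from rfl, pauliMatrix_I]
  simp only [Matrix.one_apply, Finset.prod_ite_zero, Finset.mem_univ, true_implies,
    Finset.prod_const_one, funext_iff]

theorem conjTranspose_pauliOp (g : PauliString ι) : (pauliOp g)ᴴ = pauliOp g := by
  ext s s'
  simp only [Matrix.conjTranspose_apply, pauliOp, Matrix.of_apply, star_prod]
  refine Finset.prod_congr rfl fun k _ => ?_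
  conv_rhs => rw [← conjTranspose_pauliMatrix]
  rfl

variable [DecidableEq ι]

theorem pauliOp_mul (g h : PauliString ι) :
    ∃ c : ℂ, c ^ 4 = 1 ∧ pauliOp g * pauliOp h = c • pauliOp (g + h) := by
  choose c hc hmul using fun k => pauliMatrix_mul (g k) (h k)
  refine ⟨∏ k, c k, by simp [← Finset.prod_pow, hc], ?_⟩
  simp only [pauliOp_eq_tensorOp, tensorOp_mul, hmul, tensorOp_smul, Pi.add_apply]

theorem pauliOp_mul_comm (g h : PauliString ι) :
    pauliOp g * pauliOp h = pauliSign (sympForm g h) • (pauliOp h * pauliOp g) := by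
  simp only [pauliOp_eq_tensorOp, tensorOp_mul]
  rw [sympForm, pauliSign_sum, ← tensorOp_smul]
  exact congrArg _ (funext fun k => pauliMatrix_mul_comm _ _)

theorem pauliOp_mul_self (g : PauliString ι) : pauliOp g * pauliOp g = 1 := by
  rw [← pauliOp_zero]
  simp only [pauliOp_eq_tensorOp, tensorOp_mul, pauliMatrix_mul_self]
  rfl

theorem trace_pauliOp (g : PauliString ι) :
    (pauliOp g).trace = if g = 0 then 2 ^ Fintype.card ι else 0 := by
  rw [pauliOp_eq_tensorOp, trace_tensorOp]
  simp only [trace_pauliMatrix, Finset.prod_ite_zero, Finset.mem_univ, true_implies, funext_iff,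
    Pi.zero_apply, Finset.prod_const, Finset.card_univ]

theorem pauliOp_ne_zero (g : PauliString ι) : pauliOp g ≠ 0 := by
  intro h
  have := pauliOp_mul_self g
  rw [h, zero_mul] at this
  exact zero_ne_one this

theorem commute_pauliOp_iff (g h : PauliString ι) :
    Commute (pauliOp g) (pauliOp h) ↔ sympForm g h = 0 := by
  have key := pauliOp_mul_comm g h
  constructor
  · intro hc
    rcases zmod_two_cases (sympForm g h) with h0 | h1
    · exact h0
    · exfalso
      rw [h1, ← hc.eq, pauliSign_one, neg_one_smul, eq_neg_iff_add_eq_zero, ← two_smul ℂ] at key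
      have h0 : pauliOp g * pauliOp h = 0 := by simpa using key
      have h3 := congrArg (pauliOp g * ·) h0
      simp only [← mul_assoc, pauliOp_mul_self, one_mul, mul_zero] at h3
      exact pauliOp_ne_zero h h3
  · intro h0
    rw [h0, pauliSign_zero, one_smul] at key
    exact key

/-- Trace orthogonality: the product of two distinct strings is a multiple of a nonzero string,
which is traceless. -/
theorem linearIndependent_pauliOp :
    LinearIndependent ℂ (pauliOp : PauliString ι → QOp ι) := by
  rw [Fintype.linearIndependent_iff]
  intro c hc h
  have key : ∑ g, c g * (pauliOp h * pauliOp g).trace = 0 := by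
    have := congrArg (fun M => (pauliOp h * M).trace) hc
    simpa [Finset.mul_sum, Matrix.trace_sum] using this
  rw [Finset.sum_eq_single h] at key
  · rw [pauliOp_mul_self, ← pauliOp_zero, trace_pauliOp] at key
    simpa using key
  · intro g _ hg
    obtain ⟨d, _, hd⟩ := pauliOp_mul h g
    rw [hd, Matrix.trace_smul, trace_pauliOp, if_neg, smul_zero, mul_zero]
    intro h0
    apply hg
    have hhh : h + h = 0 := funext fun k => by
      have : ∀ p : ZMod 2 × ZMod 2, p + p = 0 := by decide
      exact this _
    exact (add_left_cancel (h0.trans hhh.symm))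
  · simp

theorem span_pauliOp : Submodule.span ℂ (Set.range (pauliOp : PauliString ι → QOp ι)) = ⊤ := by
  apply linearIndependent_pauliOp.span_eq_top_of_card_eq_finrank
  rw [Module.finrank_matrix]
  simp [← mul_pow]

end PauliAlgebra

/-! ### Stabilizer bases and the span of their projectors. -/

section StabilizerBases

theorem conjTranspose_ketbra {ι : Type} (ψ : QSpace ι) : (ketbra ψ)ᴴ = ketbra ψ := by
  ext s s'
  simp [ketbra, Matrix.conjTranspose_apply, mul_comm]

variable {ι : Type} [Fintype ι] [DecidableEq ι]

theorem isStabilizerGroup_iff (S : AddSubgroup (PauliString ι)) :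
    IsStabilizerGroup S ↔ (∀ g ∈ S, ∀ h ∈ S, sympForm g h = 0) ∧
      ∀ g : PauliString ι, (∀ h ∈ S, sympForm g h = 0) → g ∈ S := by
  simp only [IsStabilizerGroup, commute_pauliOp_iff]

/-- Simultaneous diagonalization of commuting Hermitian involutions. -/
theorem exists_isStabilizerBasisOf {S : AddSubgroup (PauliString ι)} (hS : IsStabilizerGroup S) :
    ∃ Φ : OrthonormalBasis (ι → Fin 2) ℂ (QSpace ι), IsStabilizerBasisOf S Φ := by
  classical
  let T : S → Module.End ℂ (QSpace ι) := fun g => Matrix.toEuclideanLin (pauliOp g.1)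
  have hT : ∀ g, (T g).IsSymmetric := fun g =>
    Matrix.isSymmetric_toEuclideanLin_iff.mpr (conjTranspose_pauliOp g.1)
  have hcomm : Pairwise (Function.onFun Commute T) := by
    intro g h _
    change T g * T h = T h * T g
    ext1 v
    have := (hS.1 g g.2 h h.2).eq
    simp only [T, Module.End.mul_apply, Matrix.toLpLin_apply, Matrix.mulVec_mulVec, this]
  have hsq : ∀ g v, T g (T g v) = v := by
    intro g v
    simp [T, Matrix.toLpLin_apply, Matrix.mulVec_mulVec, pauliOp_mul_self]
  -- Restricting the joint eigenvalues to signs makes the index set of the decomposition finite,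
  -- which the subordinate basis needs.
  let sgn : (S → ZMod 2) → S → ℂ := fun χ g => pauliSign (χ g)
  have hsgn : Function.Injective sgn := by
    intro χ χ' h
    funext g
    have h1 : pauliSign (χ g) = pauliSign (χ' g) := congrFun h g
    rcases zmod_two_cases (χ g) with h2 | h2 <;> rcases zmod_two_cases (χ' g) with h3 | h3 <;>
      rw [h2, h3] at h1 ⊢ <;> norm_num at h1
  let V : (S → ZMod 2) → Submodule ℂ (QSpace ι) :=
    fun χ => ⨅ g, Module.End.eigenspace (T g) (sgn χ g)
  have hV : OrthogonalFamily ℂ (fun χ => V χ) fun χ => (V χ).subtypeₗᵢ :=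
    (LinearMap.IsSymmetric.orthogonalFamily_iInf_eigenspaces hT).comp hsgn
  have htop : ⨆ χ, V χ = ⊤ := by
    rw [eq_top_iff, ← LinearMap.IsSymmetric.iSup_iInf_eq_top_of_commute hT hcomm]
    refine iSup_le fun γ => ?_
    by_cases hbot : (⨅ g, Module.End.eigenspace (T g) (γ g)) = ⊥
    · rw [hbot]; exact bot_le
    obtain ⟨v, hv, hv0⟩ := Submodule.exists_mem_ne_zero_of_ne_bot hbot
    have hγ : ∀ g, ∃ x : ZMod 2, pauliSign x = γ g := by
      intro g
      have h1 : T g v = γ g • v :=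
        Module.End.mem_eigenspace_iff.mp ((Submodule.mem_iInf _).mp hv g)
      have h2 : (γ g * γ g - 1) • v = 0 := by
        have := hsq g v
        rw [h1, map_smul, h1, smul_smul] at this
        rw [sub_smul, this, one_smul, sub_self]
      have h3 : γ g * γ g = 1 := by
        have := (smul_eq_zero.mp h2).resolve_right hv0
        linear_combination this
      rcases mul_self_eq_one_iff.mp h3 with h4 | h4
      · exact ⟨0, by simp [h4]⟩
      · exact ⟨1, by simp [h4]⟩
    choose χ hχ using hγ
    have : (⨅ g, Module.End.eigenspace (T g) (γ g)) = V χ := by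
      simp only [V, sgn, hχ]
    rw [this]
    exact le_iSup V χ
  have hInternal : DirectSum.IsInternal V := by
    rw [hV.isInternal_iff, htop, Submodule.top_orthogonal_eq_bot]
  have hfin : Module.finrank ℂ (QSpace ι) = Fintype.card (ι → Fin 2) := by simp
  let Φ₀ := hInternal.subordinateOrthonormalBasis hfin hV
  refine ⟨Φ₀.reindex (Fintype.equivFin _).symm, hS, fun b g hg => ?_⟩
  rw [OrthonormalBasis.reindex_apply, Equiv.symm_symm]
  have hmem := hInternal.subordinateOrthonormalBasis_subordinate hfin (Fintype.equivFin _ b) hV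
  set χ := hInternal.subordinateOrthonormalBasisIndex hfin (Fintype.equivFin _ b) hV
  have h1 : T ⟨g, hg⟩ (Φ₀ (Fintype.equivFin _ b)) =
      pauliSign (χ ⟨g, hg⟩) • Φ₀ (Fintype.equivFin _ b) :=
    Module.End.mem_eigenspace_iff.mp ((Submodule.mem_iInf _).mp hmem ⟨g, hg⟩)
  have h2 := congrArg WithLp.ofLp h1
  rw [WithLp.ofLp_smul] at h2
  rcases zmod_two_cases (χ ⟨g, hg⟩) with h3 | h3 <;> rw [h3] at h2
  · left
    simpa [T, Matrix.toLpLin_apply] using h2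
  · right
    simpa [T, Matrix.toLpLin_apply] using h2

theorem mul_ketbra (M : QOp ι) (ψ : QSpace ι) :
    M * ketbra ψ = Matrix.of fun s s' => (M *ᵥ ψ.ofLp) s * star (ψ s') := by
  ext s s'
  simp only [Matrix.mul_apply, ketbra, Matrix.of_apply, Matrix.mulVec, dotProduct,
    Finset.sum_mul, mul_assoc]

theorem sum_ketbra (Φ : OrthonormalBasis (ι → Fin 2) ℂ (QSpace ι)) :
    ∑ b, ketbra (Φ b) = 1 := by
  ext s s'
  have h := Φ.sum_inner_mul_inner (EuclideanSpace.single s (1 : ℂ)) (EuclideanSpace.single s' 1)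
  simp only [EuclideanSpace.inner_single_left, EuclideanSpace.inner_single_right, map_one,
    one_mul] at h
  rw [Matrix.sum_apply]
  simp only [ketbra, Matrix.of_apply, Matrix.one_apply]
  refine h.trans ?_
  rw [PiLp.single_apply, apply_ite (starRingEnd ℂ), map_one, map_zero]
  exact if_congr eq_comm rfl rfl

theorem pauliOp_mul_ketbra {S : AddSubgroup (PauliString ι)} {ψ : QSpace ι}
    (hψ : IsCommonEigenvector S ψ) {g : PauliString ι} (hg : g ∈ S) :
    ∃ c : ℂ, star c = c ∧ pauliOp g * ketbra ψ = c • ketbra ψ := by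
  rcases hψ g hg with h | h
  · exact ⟨1, by simp, by rw [mul_ketbra, h, one_smul]; rfl⟩
  · refine ⟨-1, by simp, ?_⟩
    rw [mul_ketbra, h]
    ext s s'
    simp [ketbra]

theorem commute_pauliOp_ketbra {S : AddSubgroup (PauliString ι)} {ψ : QSpace ι}
    (hψ : IsCommonEigenvector S ψ) {g : PauliString ι} (hg : g ∈ S) :
    Commute (pauliOp g) (ketbra ψ) := by
  obtain ⟨c, hc, h⟩ := pauliOp_mul_ketbra hψ hg
  have h' := congrArg Matrix.conjTranspose h
  rw [Matrix.conjTranspose_mul, Matrix.conjTranspose_smul, conjTranspose_ketbra,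
    conjTranspose_pauliOp, hc] at h'
  exact h.trans h'.symm

/-- Conjugation by `g ∈ S` multiplies each Pauli coefficient of `M` by a sign. By maximality, a
string outside `S` anticommutes with some `g ∈ S`, so its coefficient equals its negative. -/
theorem mem_span_pauliOp_of_commute {S : AddSubgroup (PauliString ι)} (hS : IsStabilizerGroup S)
    {M : QOp ι} (hM : ∀ g ∈ S, Commute (pauliOp g) M) :
    M ∈ Submodule.span ℂ (pauliOp '' (S : Set (PauliString ι))) := by
  rw [isStabilizerGroup_iff] at hS
  obtain ⟨c, rfl⟩ := (Submodule.mem_span_range_iff_exists_fun ℂ).mp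
    (span_pauliOp (ι := ι) ▸ Submodule.mem_top : M ∈ Submodule.span ℂ (Set.range pauliOp))
  refine Submodule.sum_mem _ fun h _ => ?_
  by_cases hh : h ∈ S
  · exact Submodule.smul_mem _ _ (Submodule.subset_span ⟨h, hh, rfl⟩)
  suffices c h = 0 by rw [this, zero_smul]; exact zero_mem _
  have : ∃ g ∈ S, sympForm g h = 1 := by
    by_contra! hcon
    refine hh (hS.2 h fun g hg => ?_)
    rw [sympForm_comm]
    exact (zmod_two_cases _).resolve_right (hcon g hg)
  obtain ⟨g, hg, hgh⟩ := this
  have key : ∑ k, (pauliSign (sympForm g k) * c k - c k) • pauliOp k = 0 := by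
    have h1 := congrArg (· * pauliOp g) (hM g hg).eq
    simp only [mul_assoc, pauliOp_mul_self, mul_one, Finset.mul_sum, Finset.sum_mul] at h1
    simp only [sub_smul, Finset.sum_sub_distrib, sub_eq_zero]
    refine Eq.trans (Finset.sum_congr rfl fun k _ => ?_) h1
    rw [smul_mul_assoc, mul_smul_comm, ← mul_assoc, pauliOp_mul_comm g k, smul_mul_assoc,
      mul_assoc, pauliOp_mul_self, mul_one, smul_smul, mul_comm]
  have h2 := Fintype.linearIndependent_iff.mp linearIndependent_pauliOp _ key h
  rw [hgh, pauliSign_one] at h2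
  linear_combination (-1 / 2 : ℂ) * h2

/-- Each projector commutes with `S`, hence expands in `S`. Conversely, multiplying the resolution
of the identity by `g ∈ S` expands `g` in the projectors. -/
theorem span_ketbra_eq_span_pauliOp {S : AddSubgroup (PauliString ι)}
    {Φ : OrthonormalBasis (ι → Fin 2) ℂ (QSpace ι)} (h : IsStabilizerBasisOf S Φ) :
    Submodule.span ℂ (Set.range fun b => ketbra (Φ b)) =
      Submodule.span ℂ (pauliOp '' (S : Set (PauliString ι))) := by
  apply le_antisymm
  · rw [Submodule.span_le]
    rintro _ ⟨b, rfl⟩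
    exact mem_span_pauliOp_of_commute h.1 fun g hg => commute_pauliOp_ketbra (h.2 b) hg
  · rw [Submodule.span_le]
    rintro _ ⟨g, hg, rfl⟩
    choose c _ hc using fun b => pauliOp_mul_ketbra (h.2 b) hg
    rw [← mul_one (pauliOp g), ← sum_ketbra Φ, Finset.mul_sum]
    simp only [hc]
    exact Submodule.sum_mem _ fun b _ => Submodule.smul_mem _ _ (Submodule.subset_span ⟨b, rfl⟩)

end StabilizerBases

/-! ### Effective operators of Pauli strings. -/

section EffectiveOperators

variable {ι κ : Type} [Fintype ι] [DecidableEq ι] [Fintype κ] [DecidableEq κ]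

/-- The effective operator on the data qubits of an operator on the whole register, for the
ancilla state `ψ` and the evolution `U`. -/
noncomputable def effectiveOp (U : QOp (ι ⊕ κ)) (ψ : QSpace κ) : QOp (ι ⊕ κ) →ₗ[ℂ] QOp ι where
  toFun M := partialTrace (Uᴴ * M * U * idTensor (ketbra ψ))
  map_add' M N := by
    ext s s'
    simp [mul_add, add_mul, partialTrace, Finset.sum_add_distrib]
  map_smul' c M := by
    ext s s'
    simp [partialTrace, Finset.mul_sum]

theorem effectiveOp_mul (U V : QOp (ι ⊕ κ)) (ψ : QSpace κ) (M : QOp (ι ⊕ κ)) :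
    effectiveOp (V * U) ψ M = effectiveOp U ψ (Vᴴ * M * V) := by
  simp [effectiveOp, Matrix.conjTranspose_mul, mul_assoc]

theorem povmSpan_effectivePOVM (U : QOp (ι ⊕ κ)) (ψ : QSpace κ)
    {S : AddSubgroup (PauliString (ι ⊕ κ))}
    {Φ : OrthonormalBasis (ι ⊕ κ → Fin 2) ℂ (QSpace (ι ⊕ κ))} (h : IsStabilizerBasisOf S Φ) :
    povmSpan (effectivePOVM U ψ Φ) = Submodule.span ℂ
      ((fun g => effectiveOp U ψ (pauliOp g)) '' (S : Set (PauliString (ι ⊕ κ)))) := by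
  have h1 := congrArg (Submodule.map (effectiveOp U ψ)) (span_ketbra_eq_span_pauliOp h)
  rw [Submodule.map_span, Submodule.map_span, ← Set.range_comp, Set.image_image] at h1
  exact h1

/-- The product state with the same amplitudes on each qubit. -/
noncomputable def productState (κ : Type) [Fintype κ] (v : Fin 2 → ℂ) : QSpace κ :=
  WithLp.toLp 2 fun s => ∏ k, v (s k)

/-- The expectation value of a one-qubit operator. -/
noncomputable def qubitExpectation (v : Fin 2 → ℂ) (M : Matrix (Fin 2) (Fin 2) ℂ) : ℂ :=
  ∑ x, ∑ y, star (v x) * M x y * v y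

theorem partialTrace_pauliOp_mul (g : PauliString (ι ⊕ κ)) (ψ : QSpace κ) :
    partialTrace (pauliOp g * idTensor (ketbra ψ)) =
      (∑ x, ∑ y, star (ψ x) * pauliOp (g ∘ Sum.inr) x y * ψ y) • pauliOp (g ∘ Sum.inl) := by
  ext s s'
  simp only [partialTrace, Matrix.of_apply, Matrix.mul_apply, Matrix.smul_apply, smul_eq_mul,
    Finset.sum_mul]
  refine Finset.sum_congr rfl fun x _ => ?_
  rw [← (Equiv.sumArrowEquivProdArrow ι κ (Fin 2)).symm.sum_comp, Fintype.sum_prod_type,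
    Finset.sum_eq_single s']
  · refine Finset.sum_congr rfl fun y _ => ?_
    simp [Equiv.sumArrowEquivProdArrow, idTensor, pauliOp, ketbra, Fintype.prod_sum_type]
    ring
  · intro u _ hu
    refine Finset.sum_eq_zero fun y _ => ?_
    simp [Equiv.sumArrowEquivProdArrow, idTensor, hu]
  · simp

theorem expectation_productState (v : Fin 2 → ℂ) (e : PauliString κ) :
    ∑ x, ∑ y, star (productState κ v x) * pauliOp e x y * productState κ v y =
      ∏ k, qubitExpectation v (pauliMatrix (e k)) := by
  simp only [qubitExpectation, prod_sum_eq_sum_prod, productState, pauliOp, Matrix.of_apply,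
    star_prod, Finset.prod_mul_distrib]

theorem effectiveOp_one_productState (v : Fin 2 → ℂ) (g : PauliString (ι ⊕ κ)) :
    effectiveOp 1 (productState κ v) (pauliOp g) =
      (∏ k, qubitExpectation v (pauliMatrix (g (Sum.inr k)))) • pauliOp (g ∘ Sum.inl) := by
  have h := partialTrace_pauliOp_mul g (productState κ v)
  rw [expectation_productState] at h
  simpa [effectiveOp] using h

end EffectiveOperators

/-! ### The phase of `T` and one-qubit expectation values in `|+⟩` and `|T⟩`. -/

section Phase

/-- The phase `e^{iπ/4}` of the gate `T`. -/
noncomputable def tPhase : ℂ := Complex.exp (Complex.I * (Real.pi / 4))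

theorem star_tPhase_mul : star tPhase * tPhase = 1 := by
  rw [tPhase, ← starRingEnd_apply, ← Complex.exp_conj, ← Complex.exp_add]
  simp [← Complex.ofReal_ofNat, ← Complex.ofReal_div]

theorem tPhase_sq : tPhase * tPhase = Complex.I := by
  rw [tPhase, ← Complex.exp_add, show Complex.I * (Real.pi / 4) + Complex.I * (Real.pi / 4) =
    Real.pi / 2 * Complex.I by ring, Complex.exp_pi_div_two_mul_I]

theorem tPhase_add_star_ne_zero : tPhase + star tPhase ≠ 0 := by
  intro h
  have h1 : Complex.I + 1 = 0 := by
    linear_combination tPhase * h - tPhase_sq - star_tPhase_mul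
  simpa using congrArg Complex.im h1

theorem star_sub_tPhase_ne_zero : star tPhase - tPhase ≠ 0 := by
  intro h
  have h1 : Complex.I - 1 = 0 := by
    linear_combination -tPhase * h - tPhase_sq + star_tPhase_mul
  simpa using congrArg Complex.im h1

end Phase

section ProductStates

theorem inv_sqrt_two_mul_self : ((Real.sqrt 2 : ℂ))⁻¹ * (Real.sqrt 2 : ℂ)⁻¹ = 1 / 2 := by
  rw [← mul_inv, ← Complex.ofReal_mul, Real.mul_self_sqrt (by norm_num)]
  norm_num

/-- The amplitudes of `|+⟩`. -/
noncomputable def plusAmplitude : Fin 2 → ℂ := fun _ => (Real.sqrt 2 : ℂ)⁻¹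

theorem qubitExpectation_plusAmplitude (p : ZMod 2 × ZMod 2) :
    qubitExpectation plusAmplitude (pauliMatrix p) = if p.2 = 0 then 1 else 0 := by
  have h := inv_sqrt_two_mul_self
  rcases pauliLetter_cases p with rfl | rfl | rfl | rfl <;>
    simp [qubitExpectation, plusAmplitude, Fin.sum_univ_two, Complex.conj_ofReal, h]
  all_goals ring_nf

/-- The amplitudes of `|T⟩`. -/
noncomputable def magicAmplitude : Fin 2 → ℂ :=
  fun b => (if b = 1 then tPhase else 1) / (Real.sqrt 2 : ℂ)

theorem qubitExpectation_magicAmplitude_ne_zero (p : ZMod 2 × ZMod 2) :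
    qubitExpectation magicAmplitude (pauliMatrix p) ≠ 0 ↔ p ≠ (0, 1) := by
  have h := inv_sqrt_two_mul_self
  have hs : star (Real.sqrt 2 : ℂ)⁻¹ = (Real.sqrt 2 : ℂ)⁻¹ := by simp [Complex.conj_ofReal]
  have key : ∀ M : Matrix (Fin 2) (Fin 2) ℂ, qubitExpectation magicAmplitude M =
      (M 0 0 + M 0 1 * tPhase + star tPhase * M 1 0 + M 1 1) / 2 := by
    intro M
    simp only [qubitExpectation, magicAmplitude, Fin.sum_univ_two, div_eq_mul_inv, star_mul', hs]
    simp only [zero_ne_one, if_true, if_false, star_one]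
    linear_combination (M 0 0 + M 0 1 * tPhase + star tPhase * M 1 0 +
      star tPhase * tPhase * M 1 1) * h + 1 / 2 * M 1 1 * star_tPhase_mul
  rw [key]
  rcases pauliLetter_cases p with rfl | rfl | rfl | rfl
  · simp
  · simpa using tPhase_add_star_ne_zero
  · have h1 : -(Complex.I * tPhase) + star tPhase * Complex.I =
        Complex.I * (star tPhase - tPhase) := by ring
    have h2 := mul_ne_zero Complex.I_ne_zero star_sub_tPhase_ne_zero
    rw [← h1] at h2
    simpa using h2
  · simp

end ProductStates

/-! ### Pauli rotations as Clifford conjugates of `T`. -/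

section Rotations

theorem sympForm_zero {ι : Type} [Fintype ι] (g : PauliString ι) : sympForm g 0 = 0 := by
  simp [sympForm, letterForm]

theorem sympForm_self {ι : Type} [Fintype ι] (g : PauliString ι) : sympForm g g = 0 := by
  have : ∀ p : ZMod 2 × ZMod 2, letterForm p p = 0 := by decide
  simp [sympForm, this]

variable {ι : Type} [Fintype ι] [DecidableEq ι]

/-- The gate `T` with the Pauli string `P` in place of `Z`. -/
noncomputable def pauliRotation (P : PauliString ι) : QOp ι :=
  ((1 + tPhase) / 2) • (1 : QOp ι) + ((1 - tPhase) / 2) • pauliOp P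

theorem add_smul_mul_add_smul {A : Type*} [Ring A] [Algebra ℂ A] {p : A} (hp : p * p = 1)
    (a b c d : ℂ) : (a • (1 : A) + b • p) * (c • (1 : A) + d • p) =
      (a * c + b * d) • (1 : A) + (a * d + b * c) • p := by
  simp only [mul_add, add_mul, smul_mul_smul_comm, mul_one, one_mul, hp]
  module

theorem conjTranspose_pauliRotation {ι : Type} [Fintype ι] (P : PauliString ι) :
    (pauliRotation P)ᴴ =
      ((1 + star tPhase) / 2) • (1 : QOp ι) + ((1 - star tPhase) / 2) • pauliOp P := by
  simp [pauliRotation, Matrix.conjTranspose_smul, conjTranspose_pauliOp]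

theorem pauliRotation_conj (P g : PauliString ι) :
    (pauliRotation P)ᴴ * pauliOp g * pauliRotation P =
      pauliOp g * ((((1 + star tPhase) / 2) • (1 : QOp ι) +
        (pauliSign (sympForm P g) * ((1 - star tPhase) / 2)) • pauliOp P) * pauliRotation P) := by
  rw [conjTranspose_pauliRotation, ← mul_assoc]
  congr 1
  simp only [add_mul, mul_add, smul_mul_assoc, mul_smul_comm, one_mul, mul_one]
  rw [pauliOp_mul_comm P g, smul_smul, mul_comm]

theorem pauliRotation_conj_of_commute {P g : PauliString ι} (h : sympForm P g = 0) :
    (pauliRotation P)ᴴ * pauliOp g * pauliRotation P = pauliOp g := by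
  rw [pauliRotation_conj, h, pauliRotation, add_smul_mul_add_smul (pauliOp_mul_self P)]
  have h1 := star_tPhase_mul
  rw [pauliSign_zero, show (1 + star tPhase) / 2 * ((1 + tPhase) / 2) +
      1 * ((1 - star tPhase) / 2) * ((1 - tPhase) / 2) = 1 by linear_combination (1 / 2 : ℂ) * h1,
    show (1 + star tPhase) / 2 * ((1 - tPhase) / 2) +
      1 * ((1 - star tPhase) / 2) * ((1 + tPhase) / 2) = 0 by linear_combination (-1 / 2 : ℂ) * h1]
  simp

theorem pauliRotation_conj_of_anticommute {P g : PauliString ι} (h : sympForm P g = 1) :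
    (pauliRotation P)ᴴ * pauliOp g * pauliRotation P =
      ((tPhase + star tPhase) / 2) • pauliOp g +
        ((star tPhase - tPhase) / 2) • (pauliOp g * pauliOp P) := by
  rw [pauliRotation_conj, h, pauliRotation, add_smul_mul_add_smul (pauliOp_mul_self P)]
  have h1 := star_tPhase_mul
  rw [pauliSign_one, show (1 + star tPhase) / 2 * ((1 + tPhase) / 2) +
      -1 * ((1 - star tPhase) / 2) * ((1 - tPhase) / 2) = (tPhase + star tPhase) / 2 by ring,
    show (1 + star tPhase) / 2 * ((1 - tPhase) / 2) +
      -1 * ((1 - star tPhase) / 2) * ((1 + tPhase) / 2) = (star tPhase - tPhase) / 2 by ring]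
  simp [mul_add]

theorem pauliOp_single_Z (k : ι) : pauliOp (Pi.single k (0, 1) : PauliString ι) =
    Matrix.diagonal fun s => if s k = 1 then -1 else 1 := by
  ext s s'
  simp only [pauliOp, Matrix.of_apply, Matrix.diagonal_apply]
  split_ifs with h1 h2
  · subst h1
    rw [Finset.prod_eq_single k]
    · simp [h2]
    · intro j _ hj
      rw [Pi.single_eq_of_ne hj, show (0 : ZMod 2 × ZMod 2) = (0, 0) from rfl]
      simp
    · simp
  · subst h1
    rw [Finset.prod_eq_single k]
    · have : s k = 0 := by omega
      simp [this]
    · intro j _ hj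
      rw [Pi.single_eq_of_ne hj, show (0 : ZMod 2 × ZMod 2) = (0, 0) from rfl]
      simp
    · simp
  · obtain ⟨j, hj⟩ := Function.ne_iff.mp h1
    apply Finset.prod_eq_zero (Finset.mem_univ j)
    by_cases hjk : j = k
    · subst hjk
      rw [Pi.single_eq_same, pauliMatrix_Z]
      generalize s j = x at *
      generalize s' j = y at *
      fin_cases x <;> fin_cases y <;> simp at hj ⊢
    · rw [Pi.single_eq_of_ne hjk, show (0 : ZMod 2 × ZMod 2) = (0, 0) from rfl]
      simp [hj]

theorem tGate_eq_pauliRotation (k : ι) :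
    tGate k = pauliRotation (Pi.single k (0, 1) : PauliString ι) := by
  rw [pauliRotation, pauliOp_single_Z, tGate, ← tPhase]
  ext s s'
  by_cases h : s = s'
  · subst h
    simp only [Matrix.diagonal_apply_eq, Matrix.add_apply, Matrix.smul_apply, Matrix.one_apply_eq,
      smul_eq_mul]
    split_ifs <;> ring
  · simp [h]

theorem isClifford_one : IsClifford (1 : QOp ι) :=
  ⟨one_mem _, fun g => ⟨1, g, by simp, by simp⟩⟩

theorem IsClifford.mul {C D : QOp ι} (hC : IsClifford C) (hD : IsClifford D) :
    IsClifford (C * D) := by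
  refine ⟨mul_mem hC.1 hD.1, fun g => ?_⟩
  obtain ⟨c, h, hc, hh⟩ := hD.2 g
  obtain ⟨d, k, hd, hk⟩ := hC.2 h
  refine ⟨c * d, k, by rw [mul_pow, hc, hd, one_mul], ?_⟩
  calc C * D * pauliOp g * (C * D)ᴴ = C * (D * pauliOp g * Dᴴ) * Cᴴ := by
        simp only [Matrix.conjTranspose_mul, mul_assoc]
    _ = (c * d) • pauliOp k := by
        rw [hh, mul_smul_comm, smul_mul_assoc, hk, smul_smul]

/-- The reflection `(P + Q)/√2`, which exchanges the anticommuting strings `P` and `Q` by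
conjugation. -/
noncomputable def pauliExchange (P Q : PauliString ι) : QOp ι :=
  (Real.sqrt 2 : ℂ)⁻¹ • (pauliOp P + pauliOp Q)

theorem pauliExchange_conj {P Q : PauliString ι} (h : sympForm P Q = 1) (g : PauliString ι) :
    pauliExchange P Q * pauliOp g * pauliExchange P Q =
      ((pauliSign (sympForm P g) + pauliSign (sympForm Q g)) / 2) • pauliOp g +
      ((pauliSign (sympForm P g) - pauliSign (sympForm Q g)) / 2) •
        (pauliOp g * (pauliOp P * pauliOp Q)) := by
  have hQP : pauliOp Q * pauliOp P = -(pauliOp P * pauliOp Q) := by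
    rw [pauliOp_mul_comm P Q, h]; simp
  simp only [pauliExchange, smul_mul_assoc, mul_smul_comm, smul_smul, inv_sqrt_two_mul_self]
  rw [add_mul, pauliOp_mul_comm P g, pauliOp_mul_comm Q g]
  simp only [add_mul, mul_add, smul_mul_assoc, mul_assoc, pauliOp_mul_self, hQP, mul_one, mul_neg]
  module

theorem conjTranspose_pauliExchange {ι : Type} [Fintype ι] (P Q : PauliString ι) :
    (pauliExchange P Q)ᴴ = pauliExchange P Q := by
  simp [pauliExchange, Matrix.conjTranspose_smul, conjTranspose_pauliOp, Complex.conj_ofReal]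

theorem pauliExchange_mul_self {P Q : PauliString ι} (h : sympForm P Q = 1) :
    pauliExchange P Q * pauliExchange P Q = 1 := by
  have := pauliExchange_conj h 0
  rw [pauliOp_zero, sympForm_zero, sympForm_zero] at this
  simpa using this

theorem isClifford_pauliExchange {P Q : PauliString ι} (h : sympForm P Q = 1) :
    IsClifford (pauliExchange P Q) := by
  constructor
  · rw [Matrix.mem_unitaryGroup_iff, Matrix.star_eq_conjTranspose, conjTranspose_pauliExchange,
      pauliExchange_mul_self h]
  · intro g
    rw [conjTranspose_pauliExchange, pauliExchange_conj h]
    obtain ⟨c, hc, hc'⟩ := pauliOp_mul P Q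
    obtain ⟨d, hd, hd'⟩ := pauliOp_mul g (P + Q)
    rw [hc', mul_smul_comm, hd', smul_smul, smul_smul]
    have h4 : Even 4 := by decide
    rcases zmod_two_cases (sympForm P g) with h1 | h1 <;>
      rcases zmod_two_cases (sympForm Q g) with h2 | h2 <;> rw [h1, h2]
    · exact ⟨1, g, by simp, by norm_num⟩
    · exact ⟨c * d, _, by rw [mul_pow, hc, hd, one_mul], by norm_num; rfl⟩
    · exact ⟨-(c * d), _, by rw [h4.neg_pow, mul_pow, hc, hd, one_mul], by norm_num; rfl⟩
    · exact ⟨-1, g, by norm_num, by norm_num⟩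

theorem pauliRotation_eq_exchange {P Q : PauliString ι} (h : sympForm P Q = 1) :
    pauliRotation P = pauliExchange P Q * pauliRotation Q * pauliExchange P Q := by
  have h1 := pauliExchange_conj h Q
  rw [h, sympForm_self, pauliSign_one, pauliSign_zero, ← mul_assoc, pauliOp_mul_comm Q P,
    sympForm_comm, h, pauliSign_one] at h1
  simp only [smul_mul_assoc, mul_assoc, pauliOp_mul_self] at h1
  simp only [pauliRotation, mul_add, add_mul, mul_smul_comm, smul_mul_assoc, mul_one, mul_assoc,
    pauliExchange_mul_self h, h1]
  norm_num

theorem IsDoped.clifford_mul {t : ℕ} {U C : QOp ι} (hU : IsDoped t U) (hC : IsClifford C) :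
    IsDoped t (C * U) := by
  cases hU with
  | clifford D hD => exact .clifford _ (hC.mul hD)
  | step s V D k hV hD =>
    rw [mul_assoc D, ← mul_assoc C, ← mul_assoc]
    exact .step s V _ k hV (hC.mul hD)

theorem IsDoped.tGate_mul {t : ℕ} {U : QOp ι} (hU : IsDoped t U) (k : ι) :
    IsDoped (t + 1) (pauliRotation (Pi.single k (0, 1) : PauliString ι) * U) := by
  rw [← tGate_eq_pauliRotation, ← one_mul (tGate k)]
  exact .step t U 1 k hU isClifford_one

/-- A string with letter `X` or `Y` at `k` anticommutes with `Z` at `k`, so a Clifford reflection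
exchanges the two and the rotation costs one gate `T`. -/
theorem IsDoped.pauliRotation_mul {t : ℕ} {U : QOp ι} (hU : IsDoped t U) {P : PauliString ι}
    {k : ι} (h : (P k).1 = 1) : IsDoped (t + 1) (pauliRotation P * U) := by
  have h1 : sympForm P (Pi.single k (0, 1)) = 1 := by
    rw [sympForm_single]; simp [letterForm, h]
  rw [pauliRotation_eq_exchange h1, ← tGate_eq_pauliRotation, mul_assoc]
  exact .step t _ _ k (hU.clifford_mul (isClifford_pauliExchange h1)) (isClifford_pauliExchange h1)

end Rotations

/-! ### How the set of contributing strings evolves under rotations. -/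

section EffectiveSupport

theorem sympForm_ancilla {ι κ : Type} [Fintype ι] [Fintype κ]
    (P : PauliString κ) (g : PauliString (ι ⊕ κ)) :
    sympForm (Sum.elim (0 : PauliString ι) P) g = sympForm (g ∘ Sum.inr) P := by
  rw [sympForm_comm]
  simp [sympForm, Fintype.sum_sum_type, letterForm]

variable {ι κ : Type} [Fintype ι] [DecidableEq ι] [Fintype κ] [DecidableEq κ]

/-- Every Pauli string has an effective operator proportional to its part on the data qubits,
with nonzero factor exactly if its part on the ancillas satisfies `N`. -/
def HasEffectiveSupport (U : QOp (ι ⊕ κ)) (ψ : QSpace κ) (N : PauliString κ → Prop) : Prop :=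
  ∀ g : PauliString (ι ⊕ κ), ∃ c : ℂ,
    effectiveOp U ψ (pauliOp g) = c • pauliOp (g ∘ Sum.inl) ∧ (c ≠ 0 ↔ N (g ∘ Sum.inr))

theorem HasEffectiveSupport.congr {U : QOp (ι ⊕ κ)} {ψ : QSpace κ} {N N' : PauliString κ → Prop}
    (h : HasEffectiveSupport U ψ N) (hN : ∀ e, N e ↔ N' e) : HasEffectiveSupport U ψ N' := by
  have : N = N' := funext fun e => propext (hN e)
  exact this ▸ h

/-- For a string anticommuting with `P`, the new factor is a combination of the factors of `e` and
`e + P` with nonzero coefficients. Hypothesis `hP` says that at most one of these is nonzero, so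
they cannot cancel. -/
theorem HasEffectiveSupport.pauliRotation_mul {U : QOp (ι ⊕ κ)} {ψ : QSpace κ}
    {N : PauliString κ → Prop} (hU : HasEffectiveSupport U ψ N) (P : PauliString κ)
    (hP : ∀ e, sympForm e P = 1 → N e → ¬ N (e + P)) :
    HasEffectiveSupport (pauliRotation (Sum.elim (0 : PauliString ι) P) * U) ψ
      fun e => N e ∨ sympForm e P = 1 ∧ N (e + P) := by
  intro g
  rw [effectiveOp_mul]
  have hs := sympForm_ancilla (ι := ι) P g
  rcases zmod_two_cases (sympForm (g ∘ Sum.inr) P) with h | h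
  · rw [pauliRotation_conj_of_commute (hs.trans h)]
    simpa [h] using hU g
  · obtain ⟨d, hd, hmul⟩ := pauliOp_mul g (Sum.elim (0 : PauliString ι) P)
    rw [pauliRotation_conj_of_anticommute (hs.trans h), hmul]
    obtain ⟨c, hc, hcN⟩ := hU g
    obtain ⟨c', hc', hcN'⟩ := hU (g + Sum.elim (0 : PauliString ι) P)
    have hl : (g + Sum.elim (0 : PauliString ι) P) ∘ Sum.inl = g ∘ Sum.inl := by ext1 k; simp
    have hr : (g + Sum.elim (0 : PauliString ι) P) ∘ Sum.inr = g ∘ Sum.inr + P := by ext1 k; simp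
    rw [hl] at hc'
    rw [hr] at hcN'
    have hd0 : d ≠ 0 := by rintro rfl; norm_num at hd
    refine ⟨(tPhase + star tPhase) / 2 * c + (star tPhase - tPhase) / 2 * d * c', ?_, ?_⟩
    · simp only [map_add, map_smul, hc, hc', smul_smul, add_smul, mul_assoc]
    · have ha : (tPhase + star tPhase) / 2 ≠ 0 := div_ne_zero tPhase_add_star_ne_zero two_ne_zero
      have hb : (star tPhase - tPhase) / 2 ≠ 0 := div_ne_zero star_sub_tPhase_ne_zero two_ne_zero
      generalize (tPhase + star tPhase) / 2 = x at ha ⊢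
      generalize (star tPhase - tPhase) / 2 = y at hb ⊢
      have hx := hP (g ∘ Sum.inr) h
      change _ ↔ N (g ∘ Sum.inr) ∨ _ ∧ N (g ∘ Sum.inr + P)
      rw [← hcN, ← hcN'] at hx ⊢
      simp only [h, true_and]
      by_cases h0 : c = 0
      · simp [h0, hb, hd0]
      · have h1 : c' = 0 := not_not.mp (hx h0)
        simp [h0, h1, ha]

/-- The effective POVM of a stabilizer basis has the same span as the data parts of those strings
of its group that lie in the support. -/
theorem HasEffectiveSupport.povmSpan_eq {U : QOp (ι ⊕ κ)} {ψ : QSpace κ}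
    {S : AddSubgroup (PauliString (ι ⊕ κ))}
    {Φ : OrthonormalBasis (ι ⊕ κ → Fin 2) ℂ (QSpace (ι ⊕ κ))} (h : IsStabilizerBasisOf S Φ)
    {N : PauliString κ → Prop}
    (hU : HasEffectiveSupport U ψ N) :
    povmSpan (effectivePOVM U ψ Φ) = Submodule.span ℂ
      (pauliOp '' {p | ∃ g ∈ S, g ∘ Sum.inl = p ∧ N (g ∘ Sum.inr)}) := by
  rw [povmSpan_effectivePOVM U ψ h]
  apply le_antisymm <;> rw [Submodule.span_le]
  · rintro _ ⟨g, hg, rfl⟩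
    obtain ⟨c, hc, hN⟩ := hU g
    simp only [hc]
    by_cases h0 : c = 0
    · rw [h0, zero_smul]; exact zero_mem _
    · exact Submodule.smul_mem _ _ (Submodule.subset_span ⟨_, ⟨g, hg, rfl, hN.mp h0⟩, rfl⟩)
  · rintro _ ⟨_, ⟨g, hg, rfl, hN⟩, rfl⟩
    obtain ⟨c, hc, hcN⟩ := hU g
    have hc0 := hcN.mpr hN
    rw [← inv_smul_smul₀ hc0 (pauliOp (g ∘ Sum.inl)), ← hc]
    exact Submodule.smul_mem _ _ (Submodule.subset_span ⟨g, hg, rfl⟩)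

end EffectiveSupport

/-! ### Supports of the initial product states. -/

section PlusState

variable {ι κ : Type} [Fintype ι] [DecidableEq ι] [Fintype κ] [DecidableEq κ]

theorem hasEffectiveSupport_one_plus :
    HasEffectiveSupport (1 : QOp (ι ⊕ κ)) (productState κ plusAmplitude)
      fun e => ∀ k, (e k).2 = 0 := by
  intro g
  refine ⟨_, effectiveOp_one_productState plusAmplitude g, ?_⟩
  simp [qubitExpectation_plusAmplitude, Finset.prod_ite_zero]

theorem hasEffectiveSupport_one_magic :
    HasEffectiveSupport (1 : QOp (ι ⊕ κ)) (magicState κ) fun e => ∀ k, e k ≠ (0, 1) := by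
  intro g
  refine ⟨_, effectiveOp_one_productState magicAmplitude g, ?_⟩
  rw [Finset.prod_ne_zero_iff]
  simp only [qubitExpectation_magicAmplitude_ne_zero, Finset.mem_univ, true_implies,
    Function.comp_apply]

theorem isStabilizerState_plus : IsStabilizerState (productState κ plusAmplitude) := by
  constructor
  · have h2 : ‖(Real.sqrt 2 : ℂ)⁻¹‖ ^ 2 = 1 / 2 := by
      rw [norm_inv, Complex.norm_real, Real.norm_of_nonneg (Real.sqrt_nonneg 2), inv_pow,
        Real.sq_sqrt (by norm_num)]
      norm_num
    have h : ‖productState κ plusAmplitude‖ ^ 2 = 1 := by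
      rw [EuclideanSpace.norm_sq_eq]
      simp only [productState, plusAmplitude, Finset.prod_const, Finset.sum_const, norm_pow]
      rw [← pow_mul, mul_comm _ 2, pow_mul, h2]
      simp
    exact (pow_eq_one_iff_of_nonneg (norm_nonneg _) two_ne_zero).mp h
  · let S : AddSubgroup (PauliString κ) :=
      { carrier := {g | ∀ k, (g k).2 = 0}
        add_mem' := fun {g h} hg hh k => by simp [hg k, hh k]
        zero_mem' := fun k => rfl
        neg_mem' := fun {g} hg k => by simp [hg k] }
    refine ⟨S, (isStabilizerGroup_iff S).mpr ⟨fun g hg h hh => ?_, fun g hg k => ?_⟩,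
      fun g hg => ?_⟩
    · exact Finset.sum_eq_zero fun k _ => by simp [letterForm, hg k, hh k]
    · have := hg (Pi.single k (1, 0)) (fun j => by
        by_cases hj : j = k
        · subst hj; simp
        · simp [hj])
      simpa [sympForm_single, letterForm] using this
    · left
      funext s
      have h1 : ∀ k, ∑ b, pauliMatrix (g k) (s k) b = 1 := by
        intro k
        have hk : (g k).2 = 0 := hg k
        generalize s k = x
        rcases pauliLetter_cases (g k) with h | h | h | h <;> rw [h] at hk ⊢ <;>
          fin_cases x <;> simp at hk ⊢
      simp only [Matrix.mulVec, dotProduct, productState, plusAmplitude, ← Finset.sum_mul,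
        pauliOp, Matrix.of_apply, ← prod_sum_eq_sum_prod, h1, Finset.prod_const_one, one_mul]

end PlusState

/-! ### The circuit: idle gates, magic states, block rotations. -/

section BlockCircuit

theorem elim_zero_single {ι κ : Type} [DecidableEq ι] [DecidableEq κ] (k : κ)
    (p : ZMod 2 × ZMod 2) :
    Sum.elim (0 : PauliString ι) (Pi.single k p) = Pi.single (Sum.inr k) p := by
  ext1 x
  rcases x with x | x
  · simp
  · by_cases h : x = k
    · subst h; simp
    · simp [h]

variable {ι κ : Type} [Fintype ι] [DecidableEq ι] [Fintype κ] [DecidableEq κ]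

/-- Idle gates: rotations about `X` act trivially on `|+⟩`. -/
theorem exists_isDoped_idle (k : κ) (t : ℕ) :
    ∃ U : QOp (ι ⊕ κ), IsDoped t U ∧
      HasEffectiveSupport U (productState κ plusAmplitude) fun e => ∀ k, (e k).2 = 0 := by
  induction t with
  | zero => exact ⟨1, .clifford 1 isClifford_one, hasEffectiveSupport_one_plus⟩
  | succ t ih =>
    obtain ⟨U, hU, hN⟩ := ih
    refine ⟨_, hU.pauliRotation_mul (P := Sum.elim (0 : PauliString ι) (Pi.single k (1, 0)))
      (k := Sum.inr k) (by simp), (hN.pauliRotation_mul _ ?_).congr ?_⟩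
    · intro e he h0
      rw [sympForm_single] at he
      simp [letterForm, h0 k] at he
    · intro e
      refine ⟨fun h => h.elim id fun ⟨h1, h2⟩ => ?_, Or.inl⟩
      rw [sympForm_single] at h1
      have h3 := h2 k
      simp [letterForm] at h1 h3
      simp [h3] at h1

/-- Magic state preparation on the ancillas in `W`. -/
theorem exists_isDoped_magic {U₀ : QOp (ι ⊕ κ)} {ψ : QSpace κ} {t : ℕ} (hU₀ : IsDoped t U₀)
    (hN₀ : HasEffectiveSupport U₀ ψ fun e => ∀ k, (e k).2 = 0) (W : Finset κ) :
    ∃ U : QOp (ι ⊕ κ), IsDoped (t + W.card) U ∧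
      HasEffectiveSupport U ψ fun e => ∀ k, (e k).2 = 1 → k ∈ W ∧ (e k).1 = 1 := by
  induction W using Finset.induction_on with
  | empty =>
    refine ⟨U₀, hU₀, hN₀.congr fun e => forall_congr' fun k => ?_⟩
    rcases zmod_two_cases (e k).2 with h | h <;> simp [h]
  | insert j W hj ih =>
    obtain ⟨U, hU, hN⟩ := ih
    refine ⟨pauliRotation (Sum.elim (0 : PauliString ι) (Pi.single j (0, 1))) * U, ?_,
      (hN.pauliRotation_mul _ ?_).congr ?_⟩
    · rw [Finset.card_insert_of_notMem hj, ← add_assoc, elim_zero_single]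
      exact hU.tGate_mul _
    · intro e he h1 h2
      have h3 := h1 j
      -- The letters of `e` and `e + Z` at `j` differ in their `Z`-part, while before this gate both
      -- would need `Z`-part `0`.
      have h4 := h2 j
      simp only [Pi.add_apply, Pi.single_eq_same, Prod.snd_add, hj, false_and] at h3 h4
      rcases zmod_two_cases (e j).2 with h | h
      · exact h4 (by rw [h, zero_add])
      · exact h3 h
    · intro e
      have hne : ∀ k, k ≠ j → (e + (Pi.single j (0, 1) : PauliString κ)) k = e k :=
        fun k hk => by simp [hk]
      rw [sympForm_single]
      simp only [letterForm, mul_one, mul_zero, add_zero]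
      constructor
      · rintro (h | ⟨h1, h2⟩) k hk
        · exact ⟨Finset.mem_insert_of_mem (h k hk).1, (h k hk).2⟩
        · by_cases hkj : k = j
          · subst hkj
            exact ⟨Finset.mem_insert_self _ _, h1⟩
          · have := h2 k
            rw [hne k hkj] at this
            exact ⟨Finset.mem_insert_of_mem (this hk).1, (this hk).2⟩
      · intro h
        rcases zmod_two_cases (e j).2 with h0 | h0
        · left
          intro k hk
          have hkj : k ≠ j := by rintro rfl; simp [h0] at hk
          exact ⟨Finset.mem_of_mem_insert_of_ne (h k hk).1 hkj, (h k hk).2⟩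
        · right
          refine ⟨(h j h0).2, fun k hk => ?_⟩
          have hkj : k ≠ j := by
            rintro rfl
            simp [h0] at hk
          rw [hne k hkj] at hk ⊢
          exact ⟨Finset.mem_of_mem_insert_of_ne (h k hk).1 hkj, (h k hk).2⟩

variable {lam : Type} [DecidableEq lam]

/-- The parity of the `Z`-parts of a string on the block with label `i`. -/
def blockParity (W : Finset κ) (β : κ → lam) (e : PauliString κ) (i : lam) : ZMod 2 :=
  ∑ k, if k ∈ W ∧ β k = i then (e k).2 else 0

/-- The string with letter `X` on the block with label `i`. -/
def blockX (W : Finset κ) (β : κ → lam) (i : lam) : PauliString κ :=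
  fun k => if k ∈ W ∧ β k = i then (1, 0) else 0

theorem sympForm_blockX (W : Finset κ) (β : κ → lam) (e : PauliString κ) (i : lam) :
    sympForm e (blockX W β i) = blockParity W β e i := by
  refine Finset.sum_congr rfl fun k _ => ?_
  by_cases h : k ∈ W ∧ β k = i <;> simp [blockX, letterForm, h]

theorem add_blockX_snd {κ lam : Type} [DecidableEq κ] [DecidableEq lam]
    (W : Finset κ) (β : κ → lam) (e : PauliString κ) (i : lam) (k : κ) :
    ((e + blockX W β i) k).2 = (e k).2 := by
  by_cases h : k ∈ W ∧ β k = i <;> simp [blockX, h]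

theorem blockParity_add_blockX (W : Finset κ) (β : κ → lam) (e : PauliString κ) (i j : lam) :
    blockParity W β (e + blockX W β i) j = blockParity W β e j := by
  simp only [blockParity, add_blockX_snd]

/-- The strings with nonzero expectation value after the rotations about `blockX` with labels
in `s`. -/
def BlockSupport (W : Finset κ) (β : κ → lam) (s : Finset lam) (e : PauliString κ) : Prop :=
  ∃ A : lam → ZMod 2, (∀ i, A i = 1 → i ∈ s ∧ blockParity W β e i = 1) ∧
    ∀ k, (e k).2 = 1 → k ∈ W ∧ (e k).1 + A (β k) = 1

/-- Odd parity provides a site of the block with letter `Y` or `Z`. Adding `X` exchanges these two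
letters, and only `Y` is admissible there as long as the block has not been rotated. -/
theorem not_blockSupport_add_blockX {W : Finset κ} {β : κ → lam} {s : Finset lam}
    {i : lam} (hi : i ∉ s) {e : PauliString κ} (he : blockParity W β e i = 1)
    (h : BlockSupport W β s e) : ¬ BlockSupport W β s (e + blockX W β i) := by
  obtain ⟨A, hA, hA'⟩ := h
  rintro ⟨A', hB, hB'⟩
  have hAi : A i = 0 := (zmod_two_cases _).resolve_right fun h => hi (hA i h).1
  have hBi : A' i = 0 := (zmod_two_cases _).resolve_right fun h => hi (hB i h).1
  obtain ⟨k, -, hk⟩ := Finset.exists_ne_zero_of_sum_ne_zero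
    (show blockParity W β e i ≠ 0 by rw [he]; exact one_ne_zero)
  have hkb : k ∈ W ∧ β k = i := by
    by_contra h
    rw [if_neg h] at hk
    exact hk rfl
  rw [if_pos hkb] at hk
  have hk1 := (zmod_two_cases _).resolve_left hk
  have h1 := (hA' k hk1).2
  have h2 := (hB' k (by rw [add_blockX_snd, hk1])).2
  simp only [hkb.2, hAi, hBi, add_zero, Pi.add_apply, blockX, hkb.1, and_self, if_true,
    Prod.fst_add] at h1 h2
  rw [h1] at h2
  exact absurd h2 (by decide)

/-- The value `A i` records whether the branch `e + blockX W β i` of the rotation with label `i` is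
taken; that branch exists only for odd parity. -/
theorem blockSupport_insert {W : Finset κ} {β : κ → lam} {s : Finset lam} {i : lam}
    (hi : i ∉ s) (e : PauliString κ) :
    (BlockSupport W β s e ∨ blockParity W β e i = 1 ∧ BlockSupport W β s (e + blockX W β i)) ↔
      BlockSupport W β (insert i s) e := by
  have h11 : (1 : ZMod 2) + 1 = 0 := rfl
  constructor
  · rintro (⟨A, hA, hA'⟩ | ⟨hp, A, hA, hA'⟩)
    · exact ⟨A, fun j hj => ⟨Finset.mem_insert_of_mem (hA j hj).1, (hA j hj).2⟩, hA'⟩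
    · have hAi : A i = 0 := (zmod_two_cases _).resolve_right fun h => hi (hA i h).1
      refine ⟨Function.update A i 1, fun j hj => ?_, fun k hk => ?_⟩
      · by_cases hji : j = i
        · subst hji
          exact ⟨Finset.mem_insert_self _ _, hp⟩
        · rw [Function.update_of_ne hji] at hj
          have := hA j hj
          rw [blockParity_add_blockX] at this
          exact ⟨Finset.mem_insert_of_mem this.1, this.2⟩
      · obtain ⟨h1, h2⟩ := hA' k (by rw [add_blockX_snd, hk])
        refine ⟨h1, ?_⟩
        by_cases hki : β k = i
        · simpa [hki, hAi, blockX, h1] using h2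
        · rw [Function.update_of_ne hki]
          simpa [hki, blockX] using h2
  · rintro ⟨A, hA, hA'⟩
    rcases zmod_two_cases (A i) with h | h
    · left
      refine ⟨A, fun j hj => ⟨Finset.mem_of_mem_insert_of_ne (hA j hj).1 ?_, (hA j hj).2⟩, hA'⟩
      rintro rfl
      rw [h] at hj
      exact zero_ne_one hj
    · right
      refine ⟨(hA i h).2, Function.update A i 0, fun j hj => ?_, fun k hk => ?_⟩
      · have hji : j ≠ i := by
          rintro rfl
          rw [Function.update_self] at hj
          exact zero_ne_one hj
        rw [Function.update_of_ne hji] at hj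
        rw [blockParity_add_blockX]
        exact ⟨Finset.mem_of_mem_insert_of_ne (hA j hj).1 hji, (hA j hj).2⟩
      · rw [add_blockX_snd] at hk
        obtain ⟨h1, h2⟩ := hA' k hk
        refine ⟨h1, ?_⟩
        by_cases hki : β k = i
        · simpa [hki, h, blockX, h1] using h2
        · rw [Function.update_of_ne hki]
          simpa [hki, blockX] using h2

/-- An empty block has even parity and an identity string, so it needs no rotation; only labels that
occur in `W` are charged a gate. -/
theorem exists_isDoped_blocks {U₀ : QOp (ι ⊕ κ)} {ψ : QSpace κ} {t : ℕ} {W : Finset κ}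
    (hU₀ : IsDoped t U₀)
    (hN₀ : HasEffectiveSupport U₀ ψ fun e => ∀ k, (e k).2 = 1 → k ∈ W ∧ (e k).1 = 1)
    (β : κ → lam) (s : Finset lam) :
    ∃ U : QOp (ι ⊕ κ), IsDoped (t + (s.filter fun i => ∃ k ∈ W, β k = i).card) U ∧
      HasEffectiveSupport U ψ (BlockSupport W β s) := by
  induction s using Finset.induction_on with
  | empty =>
    refine ⟨U₀, hU₀, hN₀.congr fun e => ⟨fun h => ⟨0, by simp, by simpa using h⟩, ?_⟩⟩
    rintro ⟨A, hA, hA'⟩ k hk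
    have : A (β k) = 0 := (zmod_two_cases _).resolve_right fun h => by simpa using (hA _ h).1
    simpa [this] using hA' k hk
  | insert i s hi ih =>
    obtain ⟨U, hU, hN⟩ := ih
    by_cases hne : ∃ k ∈ W, β k = i
    · refine ⟨pauliRotation (Sum.elim (0 : PauliString ι) (blockX W β i)) * U, ?_,
        (hN.pauliRotation_mul _ ?_).congr ?_⟩
      · rw [Finset.filter_insert, if_pos hne, Finset.card_insert_of_notMem (by simp [hi]),
          ← add_assoc]
        obtain ⟨k, hk⟩ := hne
        exact hU.pauliRotation_mul (k := Sum.inr k) (by simp [blockX, hk])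
      · intro e he
        rw [sympForm_blockX] at he
        exact not_blockSupport_add_blockX hi he
      · intro e
        rw [sympForm_blockX]
        exact blockSupport_insert hi e
    · rw [Finset.filter_insert, if_neg hne]
      refine ⟨U, hU, hN.congr fun e => ?_⟩
      rw [← blockSupport_insert hi]
      refine ⟨Or.inl, fun h => h.elim id fun h => absurd h.1 ?_⟩
      have : blockParity W β e i = 0 :=
        Finset.sum_eq_zero fun k _ => if_neg fun h => hne ⟨k, h⟩
      rw [this]
      exact zero_ne_one

/-- A circuit with as many gates `T` as there are ancillas in `W` and labels. -/
theorem exists_isDoped_blockSupport [Fintype lam] (k : κ) (W : Finset κ) (β : κ → lam) :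
    ∃ U : QOp (ι ⊕ κ), IsDoped (W.card + Fintype.card lam) U ∧
      HasEffectiveSupport U (productState κ plusAmplitude) (BlockSupport W β Finset.univ) := by
  -- One idle gate for each empty block makes the total number of gates exact.
  obtain ⟨U₀, hU₀, hN₀⟩ := exists_isDoped_idle (ι := ι) k
    ((Finset.univ.filter fun i => ¬ ∃ k ∈ W, β k = i).card)
  obtain ⟨U₁, hU₁, hN₁⟩ := exists_isDoped_magic hU₀ hN₀ W
  obtain ⟨U, hU, hN⟩ := exists_isDoped_blocks hU₁ hN₁ β Finset.univ
  refine ⟨U, ?_, hN⟩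
  convert hU using 1
  rw [← Finset.card_univ, ← Finset.card_filter_add_card_filter_not (s := Finset.univ)
    (fun i => ∃ k ∈ W, β k = i)]
  ring

end BlockCircuit

/-! ### The Bell measurement group and the group of the magic state form. -/

section Groups

variable {n d ℓ : ℕ}

/-- The strings on the data qubits in the span of the constructed POVM, for the labelling `β` of
the data qubits by blocks. -/
def DataSupport (β : Fin n → Fin ℓ) (p : PauliString (Fin n)) : Prop :=
  ∃ A : Fin ℓ → ZMod 2, (∀ i, A i = 1 → ∑ j, (if β j = i then (p j).2 else 0) = 1) ∧
    ∀ j, (p j).2 = 1 → (p j).1 + A (β j) = 1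

theorem zmod_two_add_self (x : ZMod 2) : x + x = 0 := CharTwo.add_self_eq_zero x

theorem eq_of_letterForm_add_eq_zero {p q : ZMod 2 × ZMod 2}
    (h : ∀ x, letterForm p x + letterForm q x = 0) : q = p := by
  revert p q; decide

/-- The stabilizer group of the Bell measurement of the data qubits with the first `n` ancillas
and the measurement of `X` on the other ancillas. -/
def bellGroup (n d : ℕ) : AddSubgroup (PauliString (Fin n ⊕ Fin (n + d))) where
  carrier := {g | (∀ j, g (Sum.inr (Fin.castAdd d j)) = g (Sum.inl j)) ∧
    ∀ l, (g (Sum.inr (Fin.natAdd n l))).2 = 0}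
  add_mem' := fun {g h} hg hh => ⟨fun j => by simp [hg.1 j, hh.1 j],
    fun l => by simp [hg.2 l, hh.2 l]⟩
  zero_mem' := ⟨fun _ => rfl, fun _ => rfl⟩
  neg_mem' := fun {g} hg => ⟨fun j => by simp [hg.1 j], fun l => by simp [hg.2 l]⟩

theorem isStabilizerGroup_bellGroup (n d : ℕ) : IsStabilizerGroup (bellGroup n d) := by
  rw [isStabilizerGroup_iff]
  constructor
  · intro g hg h hh
    simp only [sympForm, Fintype.sum_sum_type, Fin.sum_univ_add, hg.1, hh.1, letterForm, hg.2,
      hh.2, mul_zero, zero_mul, add_zero, Finset.sum_const_zero, zmod_two_add_self]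
  · intro g hg
    refine ⟨fun j => eq_of_letterForm_add_eq_zero fun x => ?_, fun l => ?_⟩
    -- Testing against all pairs of equal letters `x` forces the two letters of `g` to agree.
    · have := hg (Pi.single (Sum.inl j) x + Pi.single (Sum.inr (Fin.castAdd d j)) x) (by
        constructor
        · intro i
          by_cases hi : i = j
          · subst hi; simp
          · simp [hi]
        · intro l
          have : Fin.natAdd n l ≠ Fin.castAdd d j := by
            intro h
            have := congrArg Fin.val h
            simp at this
            omega
          simp [this])
      rwa [sympForm_add, sympForm_single, sympForm_single] at this
    · have := hg (Pi.single (Sum.inr (Fin.natAdd n l)) (1, 0)) (by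
        constructor
        · intro i
          have : Fin.castAdd d i ≠ Fin.natAdd n l := by
            intro h
            have := congrArg Fin.val h
            simp at this
            omega
          simp [this]
        · intro l'
          by_cases hl : l' = l
          · subst hl; simp
          · simp [hl])
      rw [sympForm_single] at this
      simpa [letterForm] using this

/-- The Bell group copies `p` to the first `n` ancillas; the other `d` carry only `I` or `X`, on
which the support imposes no condition. -/
theorem exists_mem_bellGroup_iff (β : Fin (n + d) → Fin ℓ) (p : PauliString (Fin n)) :
    (∃ g ∈ bellGroup n d, g ∘ Sum.inl = p ∧
      BlockSupport (Finset.univ.map (Fin.castAddEmb d)) β Finset.univ (g ∘ Sum.inr)) ↔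
      DataSupport (fun j => β (Fin.castAdd d j)) p := by
  have hnat : ∀ l : Fin d, Fin.natAdd n l ∉ Finset.univ.map (Fin.castAddEmb (n := n) d) := by
    intro l hl
    obtain ⟨j, -, hj⟩ := Finset.mem_map.mp hl
    have := congrArg Fin.val hj
    simp at this
    omega
  have hcast : ∀ j : Fin n, Fin.castAdd d j ∈ Finset.univ.map (Fin.castAddEmb (n := n) d) :=
    fun j => Finset.mem_map.mpr ⟨j, Finset.mem_univ _, rfl⟩
  have key : ∀ g ∈ bellGroup n d,
      (BlockSupport (Finset.univ.map (Fin.castAddEmb d)) β Finset.univ (g ∘ Sum.inr) ↔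
        DataSupport (fun j => β (Fin.castAdd d j)) (g ∘ Sum.inl)) := by
    intro g hg
    simp only [BlockSupport, DataSupport, blockParity, Fin.sum_univ_add, Fin.forall_fin_add, hnat,
      hcast, Function.comp_apply, hg.1, hg.2, true_and, false_and, if_false,
      Finset.sum_const_zero, add_zero, Finset.mem_univ, zero_ne_one, false_implies, implies_true,
      and_true]
  constructor
  · rintro ⟨g, hg, rfl, h⟩
    exact (key g hg).mp h
  · intro h
    have hg : Sum.elim p (Fin.addCases (motive := fun _ => ZMod 2 × ZMod 2) p fun _ => 0) ∈
        bellGroup n d := ⟨fun j => by simp, fun l => by simp⟩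
    exact ⟨_, hg, rfl, (key _ hg).mpr h⟩

/-- The string with part `p` on the data qubits in the stabilizer group of the magic state
form of the construction. -/
def codeString (β : Fin n → Fin ℓ) (τ : Fin ℓ ≃ Fin ℓ) (p : PauliString (Fin n))
    (A : Fin ℓ → ZMod 2) : PauliString (Fin n ⊕ Fin (n + ℓ)) :=
  Sum.elim p (Fin.addCases (motive := fun _ => ZMod 2 × ZMod 2) (fun j => p j + (A (β j), 0))
    fun l => (∑ j, (if β j = τ l then (p j).2 else 0), A (τ l)))

variable (β : Fin n → Fin ℓ) (τ : Fin ℓ ≃ Fin ℓ)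

@[simp] theorem codeString_inl (p : PauliString (Fin n)) (A : Fin ℓ → ZMod 2) (j : Fin n) :
    codeString β τ p A (Sum.inl j) = p j := rfl

@[simp] theorem codeString_castAdd (p : PauliString (Fin n)) (A : Fin ℓ → ZMod 2) (j : Fin n) :
    codeString β τ p A (Sum.inr (Fin.castAdd ℓ j)) = p j + (A (β j), 0) := by
  simp [codeString]

@[simp] theorem codeString_natAdd (p : PauliString (Fin n)) (A : Fin ℓ → ZMod 2) (l : Fin ℓ) :
    codeString β τ p A (Sum.inr (Fin.natAdd n l)) =
      (∑ j, (if β j = τ l then (p j).2 else 0), A (τ l)) := by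
  simp [codeString]

theorem register_ext {g h : PauliString (Fin n ⊕ Fin (n + ℓ))}
    (h1 : ∀ j, g (Sum.inl j) = h (Sum.inl j))
    (h2 : ∀ j, g (Sum.inr (Fin.castAdd ℓ j)) = h (Sum.inr (Fin.castAdd ℓ j)))
    (h3 : ∀ l, g (Sum.inr (Fin.natAdd n l)) = h (Sum.inr (Fin.natAdd n l))) : g = h := by
  funext x
  rcases x with x | x
  · exact h1 x
  · exact Fin.addCases (motive := fun x => g (Sum.inr x) = h (Sum.inr x)) h2 h3 x

theorem codeString_add (p q : PauliString (Fin n)) (A B : Fin ℓ → ZMod 2) :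
    codeString β τ (p + q) (A + B) = codeString β τ p A + codeString β τ q B := by
  apply register_ext
  · simp
  · intro j
    ext
    · simp; ring
    · simp
  · intro l
    simp [← Finset.sum_add_distrib, ite_add_ite]

/-- The stabilizer group of the magic state form of the construction. -/
def codeGroup : AddSubgroup (PauliString (Fin n ⊕ Fin (n + ℓ))) :=
  (AddMonoidHom.mk' (fun x : PauliString (Fin n) × (Fin ℓ → ZMod 2) => codeString β τ x.1 x.2)
    fun x y => codeString_add β τ x.1 y.1 x.2 y.2).range

theorem mem_codeGroup {g : PauliString (Fin n ⊕ Fin (n + ℓ))} :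
    g ∈ codeGroup β τ ↔ ∃ p A, codeString β τ p A = g := by
  simp [codeGroup, AddMonoidHom.mem_range]

theorem sympForm_codeString (g : PauliString (Fin n ⊕ Fin (n + ℓ))) (p : PauliString (Fin n))
    (A : Fin ℓ → ZMod 2) :
    sympForm g (codeString β τ p A) =
      ∑ j, (letterForm (g (Sum.inl j)) (p j) + letterForm (g (Sum.inr (Fin.castAdd ℓ j))) (p j) +
        (g (Sum.inr (Fin.castAdd ℓ j))).2 * A (β j) +
        (g (Sum.inr (Fin.natAdd n (τ.symm (β j))))).2 * (p j).2) +
      ∑ i, (g (Sum.inr (Fin.natAdd n (τ.symm i)))).1 * A i := by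
  have h : ∑ l, (g (Sum.inr (Fin.natAdd n l))).2 * ∑ j, (if β j = τ l then (p j).2 else 0) =
      ∑ j, (g (Sum.inr (Fin.natAdd n (τ.symm (β j))))).2 * (p j).2 := by
    simp only [Finset.mul_sum]
    rw [Finset.sum_comm]
    refine Finset.sum_congr rfl fun j _ => ?_
    rw [Finset.sum_eq_single (τ.symm (β j))]
    · simp
    · intro l _ hl
      rw [if_neg, mul_zero]
      intro h
      exact hl (by rw [h, Equiv.symm_apply_apply])
    · simp
  have h' : ∑ l, (g (Sum.inr (Fin.natAdd n l))).1 * A (τ l) =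
      ∑ i, (g (Sum.inr (Fin.natAdd n (τ.symm i)))).1 * A i := by
    rw [← τ.sum_comp fun i => (g (Sum.inr (Fin.natAdd n (τ.symm i)))).1 * A i]
    simp
  simp only [sympForm, Fintype.sum_sum_type, Fin.sum_univ_add, codeString_inl, codeString_castAdd,
    codeString_natAdd, letterForm_add, Finset.sum_add_distrib]
  rw [← h, ← h']
  simp only [letterForm, mul_zero, zero_add, Finset.sum_add_distrib]
  ring

/-- Every term of the form between two elements occurs twice. For maximality, the parameters `p` and
`A` are read off the data qubits and the `Z`-parts of the last `ℓ` qubits; testing against `(0, A)`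
and `(p, 0)` for single entries fixes the rest. -/
theorem isStabilizerGroup_codeGroup : IsStabilizerGroup (codeGroup β τ) := by
  rw [isStabilizerGroup_iff]
  constructor
  · intro g hg h hh
    obtain ⟨q, B, rfl⟩ := (mem_codeGroup β τ).mp hg
    obtain ⟨p, A, rfl⟩ := (mem_codeGroup β τ).mp hh
    have h1 : ∑ i, (∑ j, (if β j = i then (q j).2 else 0)) * A i = ∑ j, (q j).2 * A (β j) := by
      simp only [Finset.sum_mul]
      rw [Finset.sum_comm]
      refine Finset.sum_congr rfl fun j _ => ?_
      simp [ite_mul]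
    rw [sympForm_codeString]
    simp only [codeString_inl, codeString_castAdd, codeString_natAdd, Equiv.apply_symm_apply, h1]
    rw [← Finset.sum_add_distrib]
    refine Finset.sum_eq_zero fun j _ => ?_
    simp only [letterForm, Prod.fst_add, Prod.snd_add, add_zero]
    linear_combination zmod_two_add_self ((q j).1 * (p j).2 + (q j).2 * (p j).1 +
      B (β j) * (p j).2 + (q j).2 * A (β j))
  · intro g hg
    have hg' : ∀ p A, sympForm g (codeString β τ p A) = 0 :=
      fun p A => hg _ ((mem_codeGroup β τ).mpr ⟨p, A, rfl⟩)
    simp only [sympForm_codeString] at hg'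
    refine (mem_codeGroup β τ).mpr ⟨fun j => g (Sum.inl j),
      fun i => (g (Sum.inr (Fin.natAdd n (τ.symm i)))).2, ?_⟩
    have hA : ∀ i, (g (Sum.inr (Fin.natAdd n (τ.symm i)))).1 =
        ∑ j, (if β j = i then (g (Sum.inr (Fin.castAdd ℓ j))).2 else 0) := by
      intro i
      have := hg' 0 (Pi.single i 1)
      simp only [letterForm, Pi.zero_apply, Prod.fst_zero, Prod.snd_zero, mul_zero, add_zero,
        zero_add, Pi.single_apply, mul_ite, mul_one, Finset.sum_ite_eq', Finset.mem_univ,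
        if_true] at this
      linear_combination this - zmod_two_add_self (∑ j, (if β j = i then
        (g (Sum.inr (Fin.castAdd ℓ j))).2 else 0))
    have hp : ∀ j, g (Sum.inr (Fin.castAdd ℓ j)) =
        g (Sum.inl j) + ((g (Sum.inr (Fin.natAdd n (τ.symm (β j))))).2, 0) := by
      intro j
      apply eq_of_letterForm_add_eq_zero
      intro x
      have := hg' (Pi.single j x) 0
      rw [Finset.sum_eq_single j (by intro b _ hb; simp [hb, letterForm]) (by simp)] at this
      simp only [Pi.single_eq_same, Pi.zero_apply, mul_zero, Finset.sum_const_zero, add_zero]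
        at this
      simp only [letterForm, Prod.fst_add, Prod.snd_add, add_zero] at this ⊢
      linear_combination this
    apply register_ext
    · simp
    · intro j
      simp [hp]
    · intro l
      have := hA (τ l)
      simp only [hp, Prod.snd_add, add_zero, Equiv.symm_apply_apply] at this
      ext
      · simp [this]
      · simp

/-- Magic states kill exactly the letter `Z`. On the last `ℓ` qubits, with letter `(parity, A)`, its
absence means that `A i = 1` forces odd parity; on the `n` qubits before them it gives the condition
on single letters. -/
theorem exists_mem_codeGroup_iff (p : PauliString (Fin n)) :
    (∃ g ∈ codeGroup β τ, g ∘ Sum.inl = p ∧ ∀ k, (g ∘ Sum.inr) k ≠ (0, 1)) ↔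
      DataSupport β p := by
  have hpar : ∀ x y : ZMod 2, ((x, y) : ZMod 2 × ZMod 2) ≠ (0, 1) ↔ (y = 1 → x = 1) := by decide
  have key : ∀ A, (∀ k, codeString β τ p A (Sum.inr k) ≠ (0, 1)) ↔
      (∀ i, A i = 1 → ∑ j, (if β j = i then (p j).2 else 0) = 1) ∧
        ∀ j, (p j).2 = 1 → (p j).1 + A (β j) = 1 := by
    intro A
    simp only [Fin.forall_fin_add, codeString_castAdd, codeString_natAdd, hpar,
      Prod.fst_add, Prod.snd_add, add_zero]
    rw [and_comm, τ.forall_congr_right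
      (q := fun i => A i = 1 → ∑ j, (if β j = i then (p j).2 else 0) = 1)]
  constructor
  · rintro ⟨g, hg, rfl, h⟩
    obtain ⟨p, A, rfl⟩ := (mem_codeGroup β τ).mp hg
    exact ⟨A, (key A).mp h⟩
  · rintro ⟨A, hA⟩
    exact ⟨_, (mem_codeGroup β τ).mpr ⟨p, A, rfl⟩, rfl, (key A).mpr hA⟩

theorem eq_zero_of_elim_mem_codeGroup {p : PauliString (Fin n)}
    (h : Sum.elim p (0 : PauliString (Fin (n + ℓ))) ∈ codeGroup β τ) : p = 0 := by
  obtain ⟨q, A, h⟩ := (mem_codeGroup β τ).mp h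
  have hA : A = 0 := by
    funext i
    have := congrFun h (Sum.inr (Fin.natAdd n (τ.symm i)))
    rw [codeString_natAdd] at this
    simpa using congrArg Prod.snd this
  funext j
  have h1 := congrFun h (Sum.inl j)
  have h2 := congrFun h (Sum.inr (Fin.castAdd ℓ j))
  rw [codeString_castAdd, hA] at h2
  have h3 : q j = 0 := by simpa [Prod.mk_zero_zero] using h2
  rw [codeString_inl, h3] at h1
  exact h1.symm

end Groups

/-! ### Counting the contributing data strings. -/

section Counting

theorem sum_pauliLetter (f : ZMod 2 × ZMod 2 → ℂ) :
    ∑ p, f p = f (0, 0) + f (1, 0) + f (1, 1) + f (0, 1) := by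
  rw [show (Finset.univ : Finset (ZMod 2 × ZMod 2)) = {(0, 0), (1, 0), (1, 1), (0, 1)} by decide,
    Finset.sum_insert (by decide), Finset.sum_insert (by decide), Finset.sum_insert (by decide),
    Finset.sum_singleton]
  ring

/-- The strings on one block in the span of the constructed POVM. -/
def FiberSupport {F : Type} [Fintype F] (u : PauliString F) : Prop :=
  ∃ x : ZMod 2, (x = 1 → ∑ j, (u j).2 = 1) ∧ ∀ j, (u j).2 = 1 → (u j).1 + x = 1

theorem card_fiberSupport (F : Type) [Fintype F] :
    2 * (Nat.card {u : PauliString F // FiberSupport u} : ℝ) = 3 ^ (Fintype.card F + 1) - 1 := by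
  classical
  have hsum : ∀ f : ZMod 2 × ZMod 2 → ℂ,
      ∑ u : PauliString F, ∏ j, f (u j) = (∑ p, f p) ^ Fintype.card F := by
    intro f
    rw [← Finset.card_univ, ← Finset.prod_const, Finset.prod_univ_sum, Fintype.piFinset_univ]
  -- The odd parity indicator is `(1 - (-1)^parity)/2`, so every term is a product over sites and
  -- its sum a power: `2·3^f + 3^f - 1^f`. The two cases are disjoint, since a string without `Y`
  -- and `Z` has even parity.
  have key : ∀ u : PauliString F, 2 * (if FiberSupport u then (1 : ℂ) else 0) =
      2 * ∏ j, (if u j ≠ (0, 1) then 1 else 0) + ∏ j, (if u j ≠ (1, 1) then 1 else 0) -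
        ∏ j, ((if u j ≠ (1, 1) then 1 else 0) * pauliSign (u j).2) := by
    intro u
    have h0 : ∀ p : ZMod 2 × ZMod 2, (p.2 = 1 → p.1 + 0 = 1) ↔ p ≠ (0, 1) := by decide
    have h1 : ∀ p : ZMod 2 × ZMod 2, (p.2 = 1 → p.1 + 1 = 1) ↔ p ≠ (1, 1) := by decide
    have h01 : ∀ p : ZMod 2 × ZMod 2, p ≠ (0, 1) → p ≠ (1, 1) → p.2 = 0 := by decide
    have hF : FiberSupport u ↔
        (∀ j, u j ≠ (0, 1)) ∨ (∀ j, u j ≠ (1, 1)) ∧ ∑ j, (u j).2 = 1 := by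
      constructor
      · rintro ⟨x, hx, hu⟩
        rcases zmod_two_cases x with rfl | rfl
        · exact Or.inl fun j => (h0 _).mp (hu j)
        · exact Or.inr ⟨fun j => (h1 _).mp (hu j), hx rfl⟩
      · rintro (h | ⟨h, h'⟩)
        · exact ⟨0, by simp, fun j => (h0 _).mpr (h j)⟩
        · exact ⟨1, fun _ => h', fun j => (h1 _).mpr (h j)⟩
    rw [Finset.prod_mul_distrib, ← pauliSign_sum]
    simp only [Finset.prod_ite_zero, Finset.mem_univ, true_implies, Finset.prod_const_one, hF]
    by_cases hP : ∀ j, u j ≠ (0, 1)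
    · by_cases hQ : ∀ j, u j ≠ (1, 1)
      · have : ∑ j, (u j).2 = 0 := Finset.sum_eq_zero fun j _ => h01 _ (hP j) (hQ j)
        rw [this]
        simp [hP, hQ]
      · simp [hP, hQ]
    · by_cases hQ : ∀ j, u j ≠ (1, 1)
      · rcases zmod_two_cases (∑ j, (u j).2) with h | h
        · rw [h]; simp [hP, hQ]
        · rw [h]; simp [hP, hQ]; norm_num
      · simp [hP, hQ]
  have h := Finset.sum_congr (rfl : (Finset.univ : Finset (PauliString F)) = _) fun u _ => key u
  rw [← Finset.mul_sum, Finset.sum_sub_distrib, Finset.sum_add_distrib, ← Finset.mul_sum,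
    hsum fun p => if p ≠ (0, 1) then 1 else 0, hsum fun p => if p ≠ (1, 1) then 1 else 0,
    hsum fun p => (if p ≠ (1, 1) then 1 else 0) * pauliSign p.2, sum_pauliLetter, sum_pauliLetter,
    sum_pauliLetter, Finset.sum_boole] at h
  rw [Nat.card_eq_fintype_card, Fintype.card_subtype]
  have h' : (2 * ((Finset.univ.filter fun u : PauliString F => FiberSupport u).card : ℝ) : ℂ) =
      (3 ^ (Fintype.card F + 1) - 1 : ℝ) := by
    push_cast
    rw [h]
    simp
    ring
  exact_mod_cast h'

/-- The choice of `A i` concerns the block `i` alone, so the condition decouples over the fibres of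
`β`. -/
theorem card_dataSupport {n ℓ : ℕ} (β : Fin n → Fin ℓ) :
    Nat.card {p : PauliString (Fin n) // DataSupport β p} =
      ∏ i, Nat.card {u : PauliString {j // β j = i} // FiberSupport u} := by
  have hsum : ∀ (p : PauliString (Fin n)) (i : Fin ℓ),
      ∑ j, (if β j = i then (p j).2 else 0) = ∑ j : {j // β j = i}, (p j).2 := by
    intro p i
    rw [← Finset.sum_filter]
    exact Finset.sum_subtype _ (by simp) fun j => (p j).2
  have hiff : ∀ p : PauliString (Fin n), DataSupport β p ↔
      ∀ i, FiberSupport fun j : {j // β j = i} => p j := by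
    intro p
    simp only [DataSupport, hsum]
    constructor
    · rintro ⟨A, h1, h2⟩ i
      exact ⟨A i, h1 i, fun ⟨j, hj⟩ h => by subst hj; exact h2 j h⟩
    · intro h
      choose A h1 h2 using h
      exact ⟨A, h1, fun j hj => h2 (β j) ⟨j, rfl⟩ hj⟩
  rw [← Nat.card_pi]
  refine Nat.card_congr ⟨fun p i => ⟨fun j => p.1 j, (hiff p.1).mp p.2 i⟩,
    fun u => ⟨fun j => (u (β j)).1 ⟨j, rfl⟩, (hiff _).mpr fun i => ?_⟩, fun p => rfl, fun u => ?_⟩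
  · convert (u i).2 using 2 with j
    obtain ⟨j, rfl⟩ := j
    rfl
  · funext i
    apply Subtype.ext
    funext ⟨j, hj⟩
    subst hj
    rfl

theorem finrank_span_pauliOp {ι : Type} [Fintype ι] [DecidableEq ι] (P : PauliString ι → Prop) :
    Module.finrank ℂ (Submodule.span ℂ (pauliOp '' {p | P p})) = Nat.card {p // P p} := by
  classical
  have h : LinearIndependent ℂ fun p : {p // P p} => pauliOp p.1 :=
    linearIndependent_pauliOp.comp _ Subtype.val_injective
  rw [Nat.card_eq_fintype_card, ← finrank_span_eq_card h, Set.image_eq_range]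
  rfl

end Counting

/-! ### Blocks as residue classes, and the generators `X⋯XZ`. -/

section Blocks

variable {n ℓ : ℕ}

/-- The label of a qubit: its residue modulo the number of blocks. -/
def blockLabel (hℓ : 0 < ℓ) (k : ℕ) : Fin ℓ := ⟨k % ℓ, Nat.mod_lt _ hℓ⟩

/-- The block of qubits with label `i`. -/
def labelBlock (hℓ : 0 < ℓ) (t : ℕ) (i : Fin ℓ) : Finset (Fin t) :=
  Finset.univ.filter fun k => blockLabel hℓ k = i

theorem blockLabel_eq_iff (hℓ : 0 < ℓ) (k : ℕ) (i : Fin ℓ) :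
    blockLabel hℓ k = i ↔ k ≡ i [MOD ℓ] := by
  rw [Fin.ext_iff, blockLabel, Nat.ModEq, Nat.mod_eq_of_lt i.2]

theorem card_labelBlock (hℓ : 0 < ℓ) (t : ℕ) (i : Fin ℓ) :
    (labelBlock hℓ t i).card = if (i : ℕ) < t % ℓ then t / ℓ + 1 else t / ℓ := by
  have h := Nat.count_modEq_card t hℓ i
  rw [Nat.count_eq_card_filter_range, Finset.card_filter, Finset.sum_range,
    Nat.mod_eq_of_lt i.2] at h
  rw [labelBlock, Finset.card_filter]
  simp only [blockLabel_eq_iff, h]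
  split_ifs <;> rfl

/-- Consecutive `ℓ` integers meet each residue once: every block has exactly one of the last `ℓ`
qubits, which is where its `Z` sits. -/
theorem blockLabel_add_injective (hℓ : 0 < ℓ) (n : ℕ) :
    Function.Injective fun l : Fin ℓ => blockLabel hℓ (n + l) := by
  intro i j h
  have h1 : n + i ≡ n + j [MOD ℓ] := congrArg Fin.val h
  exact Fin.ext (Nat.ModEq.eq_of_lt_of_lt (Nat.ModEq.add_left_cancel' n h1) i.isLt j.isLt)

/-- The labels of the last `ℓ` qubits. -/
noncomputable def lastLabel (hℓ : 0 < ℓ) (n : ℕ) : Fin ℓ ≃ Fin ℓ :=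
  Equiv.ofBijective _ (Finite.injective_iff_bijective.mp (blockLabel_add_injective hℓ n))

theorem lastLabel_apply (hℓ : 0 < ℓ) (l : Fin ℓ) : lastLabel hℓ n l = blockLabel hℓ (n + l) := rfl

theorem card_labelBlock_eq_card_fiber_add_one (hℓ : 0 < ℓ) (i : Fin ℓ) :
    (labelBlock hℓ (n + ℓ) i).card =
      Fintype.card {j : Fin n // blockLabel hℓ j = i} + 1 := by
  rw [labelBlock, Finset.card_filter, Fin.sum_univ_add, Fintype.card_subtype, Finset.card_filter]
  congr 1
  exact ((lastLabel hℓ n).sum_comp fun l => if l = i then 1 else 0).trans (by simp)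

theorem xxzString_castAdd (hℓ : 0 < ℓ) (i : Fin ℓ) (j : Fin n) :
    xxzString (labelBlock hℓ (n + ℓ) i) (Fin.castAdd ℓ j) =
      if blockLabel hℓ j = i then (1, 0) else 0 := by
  simp only [xxzString, labelBlock, Finset.mem_filter, Finset.mem_univ, true_and, Fin.val_castAdd]
  split_ifs with h1 h2
  · exfalso
    -- The qubit `j + ℓ` lies in the same block, so `j < n` is never its last qubit.
    have h3 := h2 ⟨j + ℓ, by omega⟩ (by rw [← h1]; simp [blockLabel])
    rw [Fin.le_def] at h3
    simp at h3
    omega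
  · rfl
  · rfl

theorem xxzString_natAdd (hℓ : 0 < ℓ) (i : Fin ℓ) (l : Fin ℓ) :
    xxzString (labelBlock hℓ (n + ℓ) i) (Fin.natAdd n l) =
      if lastLabel hℓ n l = i then (0, 1) else 0 := by
  simp only [xxzString, labelBlock, Finset.mem_filter, Finset.mem_univ, true_and, Fin.val_natAdd,
    lastLabel_apply]
  split_ifs with h1 h2
  · exact (if_pos h1).symm
  · exfalso
    refine h2 fun k hk => ?_
    rw [← h1] at hk
    have h3 : (k : ℕ) ≡ n + l [MOD ℓ] := congrArg Fin.val hk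
    rw [Fin.le_def, Fin.val_natAdd]
    by_contra! hlt
    -- A later qubit of the block would be at least `ℓ` further on, beyond the register.
    have h4 := (Nat.modEq_iff_dvd' hlt.le).mp h3.symm
    have h5 := Nat.le_of_dvd (by omega) h4
    omega
  · exact (if_neg h1).symm

theorem elim_xxzString (hℓ : 0 < ℓ) (i : Fin ℓ) :
    Sum.elim (0 : PauliString (Fin n)) (xxzString (labelBlock hℓ (n + ℓ) i)) =
      codeString (fun j => blockLabel hℓ j) (lastLabel hℓ n) 0 (Pi.single i 1) := by
  apply register_ext
  · simp
  · intro j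
    rw [Sum.elim_inr, xxzString_castAdd, codeString_castAdd]
    by_cases h : blockLabel hℓ j = i <;> simp [h, Prod.mk_zero_zero]
  · intro l
    rw [Sum.elim_inr, xxzString_natAdd, codeString_natAdd]
    by_cases h : lastLabel hℓ n l = i <;> simp [h, Prod.mk_zero_zero]

theorem elim_mem_codeGroup_iff (hℓ : 0 < ℓ) (q : PauliString (Fin (n + ℓ))) :
    Sum.elim (0 : PauliString (Fin n)) q ∈
        codeGroup (fun j => blockLabel hℓ j) (lastLabel hℓ n) ↔
      q ∈ AddSubgroup.closure (Set.range fun i => xxzString (labelBlock hℓ (n + ℓ) i)) := by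
  constructor
  · intro h
    obtain ⟨p, A, h⟩ := (mem_codeGroup _ _).mp h
    have hp : p = 0 := funext fun j => congrFun h (Sum.inl j)
    subst hp
    -- The elements with trivial data part are parametrized by `A`, whose entries are the exponents
    -- of the generators.
    have hq : q = ∑ i, (A i).val • xxzString (labelBlock hℓ (n + ℓ) i) := by
      have hval : ∀ (x : ZMod 2) (y : ZMod 2 × ZMod 2), x.val • y = (x * y.1, x * y.2) := by
        decide
      funext k
      rw [Finset.sum_apply]
      revert k
      rw [Fin.forall_fin_add]
      constructor
      · intro j
        have := congrFun h (Sum.inr (Fin.castAdd ℓ j))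
        rw [codeString_castAdd, Sum.elim_inr] at this
        rw [← this, Finset.sum_eq_single (blockLabel hℓ j)]
        · simp [xxzString_castAdd, hval]
        · intro i _ hi
          simp [xxzString_castAdd, hi.symm]
        · simp
      · intro l
        have := congrFun h (Sum.inr (Fin.natAdd n l))
        rw [codeString_natAdd, Sum.elim_inr] at this
        rw [← this, Finset.sum_eq_single (lastLabel hℓ n l)]
        · simp [xxzString_natAdd, hval]
        · intro i _ hi
          simp [xxzString_natAdd, hi.symm]
        · simp
    rw [hq]
    exact sum_mem fun i _ => AddSubgroup.nsmul_mem _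
      (AddSubgroup.subset_closure (Set.mem_range_self i)) _
  · intro h
    induction h using AddSubgroup.closure_induction with
    | mem x hx =>
      obtain ⟨i, rfl⟩ := hx
      exact (mem_codeGroup _ _).mpr ⟨0, Pi.single i 1, (elim_xxzString hℓ i).symm⟩
    | zero =>
      rw [show Sum.elim (0 : PauliString (Fin n)) (0 : PauliString (Fin (n + ℓ))) = 0 from
        funext fun x => by rcases x with x | x <;> rfl]
      exact zero_mem _
    | add x y _ _ hx hy =>
      rw [show Sum.elim (0 : PauliString (Fin n)) (x + y) =
          Sum.elim (0 : PauliString (Fin n)) x + Sum.elim (0 : PauliString (Fin n)) y from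
        funext fun z => by rcases z with z | z <;> simp]
      exact add_mem hx hy
    | neg x _ hx =>
      rw [show Sum.elim (0 : PauliString (Fin n)) (-x) = -Sum.elim (0 : PauliString (Fin n)) x from
        funext fun z => by rcases z with z | z <;> simp]
      exact neg_mem hx

theorem card_dataSupport_eq_dopedBound (hℓ : 0 < ℓ) :
    (Nat.card {p : PauliString (Fin n) // DataSupport (fun j => blockLabel hℓ j) p} : ℝ) =
      dopedBound ℓ ((n + ℓ) / ℓ) ((n + ℓ) % ℓ) := by
  set a := (n + ℓ) / ℓ
  set r := (n + ℓ) % ℓ with hr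
  have hcard : ∀ i, (Nat.card {u : PauliString {j : Fin n // blockLabel hℓ j = i} //
      FiberSupport u} : ℝ) = if (i : ℕ) < r then (3 ^ (a + 1) - 1) / 2 else (3 ^ a - 1) / 2 := by
    intro i
    have h := card_fiberSupport {j : Fin n // blockLabel hℓ j = i}
    rw [← card_labelBlock_eq_card_fiber_add_one, card_labelBlock] at h
    split_ifs at h ⊢ <;> linarith
  have hrl : r ≤ ℓ := (Nat.mod_lt _ hℓ).le
  rw [card_dataSupport, Nat.cast_prod]
  simp only [hcard]
  rw [Finset.prod_ite, Finset.prod_const, Finset.prod_const, Finset.filter_not,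
    Finset.card_sdiff_of_subset (Finset.filter_subset _ _), Fin.card_filter_val_lt,
    Finset.card_univ, Fintype.card_fin, min_eq_right hrl, dopedBound, div_pow, div_pow]
  have h2 : (2 : ℝ) ^ ℓ = 2 ^ r * 2 ^ (ℓ - r) := by rw [← pow_add, Nat.add_sub_cancel' hrl]
  rw [h2]
  field_simp

end Blocks

theorem theorem7 (n m t ℓ a r : ℕ) (hn : 1 ≤ n) (hm : n ≤ m) (ht : n < t)
    (hℓ : ℓ = t - n) (ha : a = t / ℓ) (hr : r = t - a * ℓ) :
    (∃ A : ℕ, IsGreatest {s : ℕ | ∃ μ, IsDopedPOVM n m t μ ∧ s = povmDim μ} A ∧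
      dopedBound ℓ a r ≤ (A : ℝ)) ∧
    (∃ (μ : (Fin n ⊕ Fin m → Fin 2) → QOp (Fin n)) (B : Fin ℓ → Finset (Fin t))
      (S : AddSubgroup (PauliString (Fin n ⊕ Fin t)))
      (Φ : OrthonormalBasis (Fin n ⊕ Fin t → Fin 2) ℂ (QSpace (Fin n ⊕ Fin t))),
      IsDopedPOVM n m t μ ∧ (povmDim μ : ℝ) = dopedBound ℓ a r ∧
      (∀ i j, i ≠ j → Disjoint (B i) (B j)) ∧
      (∀ i, (B i).card = if (i : ℕ) < r then a + 1 else a) ∧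
      (∀ p : PauliString (Fin n), Sum.elim p (0 : PauliString (Fin t)) ∈ S → p = 0) ∧
      (∀ q : PauliString (Fin t), Sum.elim (0 : PauliString (Fin n)) q ∈ S ↔
        q ∈ AddSubgroup.closure (Set.range fun i => xxzString (B i))) ∧
      IsStabilizerBasisOf S Φ ∧
      povmSpan μ = povmSpan (effectivePOVM 1 (magicState (Fin t)) Φ)) := by
  -- Part (i) follows from the witness of (ii), as every span lies in the finite-dimensional
  -- operator space.
  refine (and_iff_right_of_imp ?_).mpr ?_
  · rintro ⟨μ, _, _, _, hμ, hdim, _⟩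
    have hbdd : BddAbove {s : ℕ | ∃ μ, IsDopedPOVM n m t μ ∧ s = povmDim μ} := by
      refine ⟨Module.finrank ℂ (QOp (Fin n)), ?_⟩
      rintro _ ⟨ν, _, rfl⟩
      exact Submodule.finrank_le _
    have hmem : povmDim μ ∈ {s : ℕ | ∃ μ, IsDopedPOVM n m t μ ∧ s = povmDim μ} := ⟨μ, hμ, rfl⟩
    refine ⟨_, ⟨Nat.sSup_mem ⟨_, hmem⟩ hbdd, fun s hs => le_csSup hbdd hs⟩, ?_⟩
    rw [← hdim]
    exact_mod_cast le_csSup hbdd hmem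
  have hpos : 0 < ℓ := by omega
  obtain rfl : t = n + ℓ := by omega
  obtain ⟨d, rfl⟩ := Nat.exists_eq_add_of_le hm
  have hr' : r = (n + ℓ) % ℓ := by
    rw [hr, ha, Nat.mod_eq_sub, mul_comm]
  subst ha hr'
  -- Ancilla `0` hosts the idle gates. The first `n` ancillas become magic, which with the `ℓ`
  -- labels gives `n + ℓ = t` gates.
  obtain ⟨U, hU, hN⟩ := exists_isDoped_blockSupport (ι := Fin n) (⟨0, by omega⟩ : Fin (n + d))
    (Finset.univ.map (Fin.castAddEmb (n := n) d)) fun k => blockLabel hpos k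
  rw [Finset.card_map, Finset.card_univ, Fintype.card_fin, Fintype.card_fin] at hU
  obtain ⟨Φ, hΦ⟩ := exists_isStabilizerBasisOf (isStabilizerGroup_bellGroup n d)
  obtain ⟨Φ', hΦ'⟩ := exists_isStabilizerBasisOf
    (isStabilizerGroup_codeGroup (fun j : Fin n => blockLabel hpos j) (lastLabel hpos n))
  have hspan := hN.povmSpan_eq hΦ
  have hspan' := hasEffectiveSupport_one_magic.povmSpan_eq hΦ'
  simp only [exists_mem_bellGroup_iff, Fin.val_castAdd] at hspan
  simp only [exists_mem_codeGroup_iff] at hspan'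
  refine ⟨_, labelBlock hpos (n + ℓ), _, Φ',
    ⟨U, _, Φ, hU, isStabilizerState_plus, ⟨_, hΦ⟩, rfl⟩, ?_, ?_, card_labelBlock hpos _,
    fun p hp => eq_zero_of_elim_mem_codeGroup _ _ hp, elim_mem_codeGroup_iff hpos, hΦ',
    hspan.trans hspan'.symm⟩
  · rw [povmDim, hspan, finrank_span_pauliOp, card_dataSupport_eq_dopedBound]
  · intro i j hij
    rw [Finset.disjoint_left]
    intro k hi hj
    simp only [labelBlock, Finset.mem_filter, Finset.mem_univ, true_and] at hi hj
    exact hij (hi.symm.trans hj)
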